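/- Let $\Omega\subset\mathbb R^2$ be a bounded domain (a bounded, connected, nonempty open set) whose boundary $\Gamma=\partial\Omega$ is of class $C^1$ (in particular, $\Gamma$ may be smooth), with $\Omega$ lying locally on one side of $\Gamma$. Let $\Gamma$ be partitioned into three measurable parts $\Gamma_1,\Gamma_2,\Gamma_3$ of positive one-dimensional measure. Let $\xi>0$ and $g>0$ be constants, $f_0\in L^2(\Omega)$ and $f_2\in L^2(\Gamma_2)$. Let $\gamma:H^1(\Omega)\to L^2(\Gamma)$ be the trace operator and put $$X=\{v\in H^1(\Omega)\mid \gamma v=0 \text{ a.e. on } \Gamma_1\},\qquad (u,v)_X=(\nabla u,\nabla v)_{L^2(\Omega)^2}.$$ Let $H^{1/2}(\Gamma)=\gamma(H^1(\Omega))$, with the norm $\|w\|=\inf\{\|v\|_{H^1(\Omega)}\mid v\in H^1(\Omega),\ \gamma v=w\}$, let $M=\gamma(X)\subset H^{1/2}(\Gamma)$ with the same norm, and let $Y=M'$ be the dual space of $M$, with duality pairing $\langle\cdot,\cdot\rangle_{Y,M}$. For $u,v\in X$ put $$a(u,v)=\xi\,(u,v)_X,\qquad (f,v)_X=\int_\Omega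 f_0\,v\,dx+\int_{\Gamma_2} f_2\,\gamma v\,d\Gamma,$$ and let $$\Lambda=\Big\{\mu\in Y\ \Big|\ \langle\mu,\gamma v\rangle_{Y,M}\le\int_{\Gamma_3} g\,|\gamma v|\,d\Gamma\ \text{ for all } v\in X\Big\}.$$ Then there is exactly one pair $(u,\lambda)\in X\times\Lambda$ such that $$a(u,v)+\langle\lambda,\gamma v\rangle_{Y,M}=(f,v)_X\quad\text{for all } v\in X,$$ $$\langle\mu-\lambda,\gamma u\rangle_{Y,M}\le 0\quad\text{for all } \mu\in\Lambda.$$ -/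

import Mathlib

open MeasureTheory Set Metric Topology
open scoped ContDiff ENNReal Gradient

noncomputable section

namespace AntiplaneContact

/-- The Euclidean plane `ℝ²`. -/
abbrev Plane : Type := EuclideanSpace ℝ (Fin 2)

/-! ### The domain and its boundary -/

/-- `Ω` has a boundary of class `C¹`: near each boundary point, after a rigid change of the
coordinate axes, `Ω` is the set of points lying strictly above the graph of a `C¹` function of
one variable. -/
def HasC1Boundary (Ω : Set Plane) : Prop :=
  ∀ x ∈ frontier Ω, ∃ (L : Plane ≃ₗᵢ[ℝ] Plane) (h : ℝ → ℝ) (r : ℝ),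
    ContDiff ℝ 1 h ∧ 0 < r ∧ ∀ y ∈ ball x r, (y ∈ Ω ↔ h (L y 0) < L y 1)

/-- Arc length on the boundary `Γ = ∂Ω`: the one-dimensional Hausdorff measure restricted
to `Γ`. -/
def bdryMeasure (Ω : Set Plane) : Measure Plane :=
  (Measure.hausdorffMeasure 1 : Measure Plane).restrict (frontier Ω)

/-- The boundary of `Ω` is the disjoint union of three measurable parts of positive length. -/
structure IsBoundaryPartition (Ω Γ₁ Γ₂ Γ₃ : Set Plane) : Prop where
  meas₁ : MeasurableSet Γ₁
  meas₂ : MeasurableSet Γ₂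
  meas₃ : MeasurableSet Γ₃
  disj₁₂ : Disjoint Γ₁ Γ₂
  disj₁₃ : Disjoint Γ₁ Γ₃
  disj₂₃ : Disjoint Γ₂ Γ₃
  union_eq : Γ₁ ∪ Γ₂ ∪ Γ₃ = frontier Ω
  pos₁ : 0 < bdryMeasure Ω Γ₁
  pos₂ : 0 < bdryMeasure Ω Γ₂
  pos₃ : 0 < bdryMeasure Ω Γ₃

/-! ### The Sobolev space `H¹(Ω)` -/

/-- `L²(Ω)`. -/
abbrev L2 (Ω : Set Plane) : Type := Lp ℝ 2 (volume.restrict Ω)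

/-- `L²(Ω)²`, the square integrable vector fields. -/
abbrev L2Vec (Ω : Set Plane) : Type := Lp Plane 2 (volume.restrict Ω)

/-- `L²(Γ)`, where `Γ = ∂Ω`. -/
abbrev L2Bdry (Ω : Set Plane) : Type := Lp ℝ 2 (bdryMeasure Ω)

/-- `G` is the weak gradient of `u` in `Ω`: integration by parts holds against all test
functions `φ ∈ C_c^∞(Ω)`. -/
def IsWeakGradient (Ω : Set Plane) (u : L2 Ω) (G : L2Vec Ω) : Prop :=
  ∀ φ : Plane → ℝ, ContDiff ℝ ∞ φ → HasCompactSupport φ → tsupport φ ⊆ Ω → ∀ i : Fin 2,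
    ∫ x in Ω, u x * (∇ φ x) i = - ∫ x in Ω, G x i * φ x

theorem continuous_gradient_apply {φ : Plane → ℝ} (hφ : ContDiff ℝ ∞ φ) (i : Fin 2) :
    Continuous fun x => (∇ φ x) i := by
  have h : Continuous fun x => ∇ φ x :=
    (InnerProductSpace.toDual ℝ Plane).symm.continuous.comp (hφ.continuous_fderiv (by simp))
  exact (PiLp.continuous_apply 2 _ i).comp h

theorem hasCompactSupport_gradient_apply {φ : Plane → ℝ} (hc : HasCompactSupport φ)
    (i : Fin 2) : HasCompactSupport fun x => (∇ φ x) i := by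
  refine (hc.fderiv (𝕜 := ℝ)).comp_left (g := fun l : StrongDual ℝ Plane =>
    ((InnerProductSpace.toDual ℝ Plane).symm l) i) ?_
  simp

theorem integrable_mul_test {Ω : Set Plane} (u : L2 Ω) {ψ : Plane → ℝ} (hψ : Continuous ψ)
    (hc : HasCompactSupport ψ) : Integrable (fun x => u x * ψ x) (volume.restrict Ω) :=
  (Lp.memLp u).integrable_mul (q := 2) (hψ.memLp_of_hasCompactSupport hc)

theorem integrable_coord_mul_test {Ω : Set Plane} (G : L2Vec Ω) (i : Fin 2) {ψ : Plane → ℝ}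
    (hψ : Continuous ψ) (hc : HasCompactSupport ψ) :
    Integrable (fun x => G x i * ψ x) (volume.restrict Ω) := by
  have h : MemLp (fun x => G x i) 2 (volume.restrict Ω) :=
    (EuclideanSpace.proj (𝕜 := ℝ) i).comp_memLp' (Lp.memLp G)
  exact h.integrable_mul (q := 2) (hψ.memLp_of_hasCompactSupport hc)

/-- The linear space of all pairs `(u, ∇u)` consisting of a function `u ∈ L²(Ω)` and its weak
gradient in `L²(Ω)²`. -/
def weakGradientGraph (Ω : Set Plane) : Submodule ℝ (WithLp 2 (L2 Ω × L2Vec Ω)) where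
  carrier := {p | IsWeakGradient Ω p.fst p.snd}
  zero_mem' := by
    intro φ _ _ _ i
    have h1 : ∀ᵐ x ∂(volume.restrict Ω), (0 : L2 Ω) x * (∇ φ x) i = 0 := by
      filter_upwards [Lp.coeFn_zero ℝ 2 (volume.restrict Ω)] with x hx
      rw [hx]; simp
    have h2 : ∀ᵐ x ∂(volume.restrict Ω), (0 : L2Vec Ω) x i * φ x = 0 := by
      filter_upwards [Lp.coeFn_zero Plane 2 (volume.restrict Ω)] with x hx
      rw [hx]; simp
    change ∫ x in Ω, (0 : L2 Ω) x * (∇ φ x) i = - ∫ x in Ω, (0 : L2Vec Ω) x i * φ x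
    rw [integral_congr_ae h1, integral_congr_ae h2]
    simp
  add_mem' := by
    intro p q hp hq φ hφ hc hs i
    have hg := continuous_gradient_apply hφ i
    have hgc := hasCompactSupport_gradient_apply hc i
    have h1 : ∀ᵐ x ∂(volume.restrict Ω), (p.fst + q.fst) x * (∇ φ x) i =
        p.fst x * (∇ φ x) i + q.fst x * (∇ φ x) i := by
      filter_upwards [Lp.coeFn_add p.fst q.fst] with x hx
      rw [hx, Pi.add_apply]; ring
    have h2 : ∀ᵐ x ∂(volume.restrict Ω), (p.snd + q.snd) x i * φ x =
        p.snd x i * φ x + q.snd x i * φ x := by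
      filter_upwards [Lp.coeFn_add p.snd q.snd] with x hx
      rw [hx, Pi.add_apply, PiLp.add_apply]; ring
    change ∫ x in Ω, (p.fst + q.fst) x * (∇ φ x) i = - ∫ x in Ω, (p.snd + q.snd) x i * φ x
    rw [integral_congr_ae h1, integral_congr_ae h2,
      integral_add (integrable_mul_test _ hg hgc) (integrable_mul_test _ hg hgc),
      integral_add (integrable_coord_mul_test _ i hφ.continuous hc)
        (integrable_coord_mul_test _ i hφ.continuous hc), hp φ hφ hc hs i, hq φ hφ hc hs i]
    ring
  smul_mem' := by
    intro c p hp φ hφ hc hs i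
    have h1 : ∀ᵐ x ∂(volume.restrict Ω), (c • p.fst) x * (∇ φ x) i =
        c * (p.fst x * (∇ φ x) i) := by
      filter_upwards [Lp.coeFn_smul c p.fst] with x hx
      rw [hx, Pi.smul_apply, smul_eq_mul]; ring
    have h2 : ∀ᵐ x ∂(volume.restrict Ω), (c • p.snd) x i * φ x =
        c * (p.snd x i * φ x) := by
      filter_upwards [Lp.coeFn_smul c p.snd] with x hx
      rw [hx, Pi.smul_apply, PiLp.smul_apply, smul_eq_mul]; ring
    change ∫ x in Ω, (c • p.fst) x * (∇ φ x) i = - ∫ x in Ω, (c • p.snd) x i * φ x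
    rw [integral_congr_ae h1, integral_congr_ae h2, integral_const_mul, integral_const_mul,
      hp φ hφ hc hs i]
    ring

/-- The Sobolev space `H¹(Ω)`: the functions `u ∈ L²(Ω)` with a weak gradient in `L²(Ω)²`, each
of them recorded together with its (uniquely determined) weak gradient. -/
def H1 (Ω : Set Plane) : Type := weakGradientGraph Ω

instance (Ω : Set Plane) : NormedAddCommGroup (H1 Ω) :=
  inferInstanceAs (NormedAddCommGroup (weakGradientGraph Ω))

/-- The usual inner product `(u, v)_{L²(Ω)} + (∇u, ∇v)_{L²(Ω)²}` on `H¹(Ω)`, inherited from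
`L²(Ω) × L²(Ω)²`. -/
instance (Ω : Set Plane) : InnerProductSpace ℝ (H1 Ω) :=
  inferInstanceAs (InnerProductSpace ℝ (weakGradientGraph Ω))

/-- The function underlying an element of `H¹(Ω)`. -/
def funOf {Ω : Set Plane} (v : H1 Ω) : L2 Ω := (Subtype.val v : WithLp 2 (L2 Ω × L2Vec Ω)).fst

/-- The weak gradient of an element of `H¹(Ω)`. -/
def gradOf {Ω : Set Plane} (v : H1 Ω) : L2Vec Ω :=
  (Subtype.val v : WithLp 2 (L2 Ω × L2Vec Ω)).snd

/-! ### The trace operator -/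

/-- The graph of the restriction map `φ|_Ω ↦ φ|_Γ` on smooth functions `φ ∈ C_c^∞(ℝ²)`, as a
subspace of `H¹(Ω) × L²(Γ)`. -/
def restrictionGraph (Ω : Set Plane) : Submodule ℝ (H1 Ω × L2Bdry Ω) where
  carrier := {p | ∃ φ : Plane → ℝ, ContDiff ℝ ∞ φ ∧ HasCompactSupport φ ∧
    funOf p.1 =ᵐ[volume.restrict Ω] φ ∧ gradOf p.1 =ᵐ[volume.restrict Ω] ∇ φ ∧
    p.2 =ᵐ[bdryMeasure Ω] φ}
  zero_mem' := by
    refine ⟨0, contDiff_const, HasCompactSupport.zero, ?_, ?_, ?_⟩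
    · exact Lp.coeFn_zero ℝ 2 (volume.restrict Ω)
    · filter_upwards [Lp.coeFn_zero Plane 2 (volume.restrict Ω)] with x hx
      have h0 : ∇ (0 : Plane → ℝ) x = 0 := gradient_fun_const x 0
      rw [h0]
      exact hx
    · exact Lp.coeFn_zero ℝ 2 (bdryMeasure Ω)
  add_mem' := by
    rintro p q ⟨φ, hφ, hφc, h1, h2, h3⟩ ⟨ψ, hψ, hψc, k1, k2, k3⟩
    refine ⟨φ + ψ, hφ.add hψ, hφc.add hψc, ?_, ?_, ?_⟩
    · exact (Lp.coeFn_add (funOf p.1) (funOf q.1)).trans (h1.add k1)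
    · refine (Lp.coeFn_add (gradOf p.1) (gradOf q.1)).trans ((h2.add k2).trans ?_)
      refine Filter.Eventually.of_forall fun x => ?_
      have h := fderiv_add ((hφ.differentiable (by simp)) x) ((hψ.differentiable (by simp)) x)
      simp only [Pi.add_apply, gradient, h, map_add]
    · exact (Lp.coeFn_add p.2 q.2).trans (h3.add k3)
  smul_mem' := by
    rintro c p ⟨φ, hφ, hφc, h1, h2, h3⟩
    refine ⟨c • φ, hφ.const_smul c, hφc.smul_left (f := fun _ => c), ?_, ?_, ?_⟩
    · exact (Lp.coeFn_smul c (funOf p.1)).trans (h1.const_smul c)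
    · refine (Lp.coeFn_smul c (gradOf p.1)).trans ((h2.const_smul c).trans ?_)
      refine Filter.Eventually.of_forall fun x => ?_
      have h := fderiv_const_smul ((hφ.differentiable (by simp)) x) c
      simp only [Pi.smul_apply, gradient, h, map_smul]
    · exact (Lp.coeFn_smul c p.2).trans (h3.const_smul c)

/-- The trace operator `γ : H¹(Ω) → L²(Γ)`: the extension by continuity (the closure) of the
restriction map `φ|_Ω ↦ φ|_Γ`, `φ ∈ C_c^∞(ℝ²)`. For a bounded domain with `C¹` boundary the
restriction map is bounded for the `H¹(Ω)` norm and the smooth functions are dense, so that `γ`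
is single valued, bounded and has domain `H¹(Ω)`. -/
def trace (Ω : Set Plane) : H1 Ω →ₗ.[ℝ] L2Bdry Ω :=
  (restrictionGraph Ω).topologicalClosure.toLinearPMap

/-! ### The spaces `X`, `H^{1/2}(Γ)`, `M = γ(X)` and `Y = M'` -/

/-- `X = {v ∈ H¹(Ω) | γ v = 0 a.e. on Γ₁}`. -/
def X (Ω Γ₁ : Set Plane) : Submodule ℝ (trace Ω).domain where
  carrier := {v | ∀ᵐ x ∂((bdryMeasure Ω).restrict Γ₁), trace Ω v x = 0}
  zero_mem' := by
    have h := ae_restrict_of_ae (s := Γ₁) (Lp.coeFn_zero ℝ 2 (bdryMeasure Ω))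
    change ∀ᵐ x ∂((bdryMeasure Ω).restrict Γ₁), trace Ω 0 x = 0
    rw [LinearPMap.map_zero]
    filter_upwards [h] with x hx
    rw [hx, Pi.zero_apply]
  add_mem' := by
    intro v w hv hw
    change ∀ᵐ x ∂((bdryMeasure Ω).restrict Γ₁), trace Ω (v + w) x = 0
    rw [LinearPMap.map_add]
    filter_upwards [hv, hw, ae_restrict_of_ae (s := Γ₁)
      (Lp.coeFn_add (trace Ω v) (trace Ω w))] with x h1 h2 h3
    rw [h3, Pi.add_apply, h1, h2, add_zero]
  smul_mem' := by
    intro c v hv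
    change ∀ᵐ x ∂((bdryMeasure Ω).restrict Γ₁), trace Ω (c • v) x = 0
    rw [LinearPMap.map_smul]
    filter_upwards [hv, ae_restrict_of_ae (s := Γ₁)
      (Lp.coeFn_smul c (trace Ω v))] with x h1 h3
    rw [h3, Pi.smul_apply, h1, smul_zero]

/-- The inner product `(u, v)_X = (∇u, ∇v)_{L²(Ω)²}` on `X`. -/
def innerX {Ω Γ₁ : Set Plane} (u v : X Ω Γ₁) : ℝ :=
  inner ℝ (gradOf u.1.1) (gradOf v.1.1)

/-- `H^{1/2}(Γ)`: the space of all traces of elements of `H¹(Ω)`. -/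
def HHalf (Ω : Set Plane) : Type := (trace Ω).toFun.range

instance (Ω : Set Plane) : AddCommGroup (HHalf Ω) :=
  inferInstanceAs (AddCommGroup (trace Ω).toFun.range)

instance (Ω : Set Plane) : Module ℝ (HHalf Ω) :=
  inferInstanceAs (Module ℝ (trace Ω).toFun.range)

/-- The linear isomorphism `H^{1/2}(Γ) ≃ H¹(Ω) / ker γ`. -/
def HHalf.equivQuot (Ω : Set Plane) :
    HHalf Ω ≃ₗ[ℝ] ((trace Ω).domain ⧸ (trace Ω).toFun.ker) :=
  (trace Ω).toFun.quotKerEquivRange.symm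

instance isClosed_ker_trace (Ω : Set Plane) :
    IsClosed ((trace Ω).toFun.ker : Set (trace Ω).domain) := by
  by_cases hg : ∀ p ∈ (restrictionGraph Ω).topologicalClosure, p.1 = 0 → p.2 = 0
  · have h : ((trace Ω).toFun.ker : Set (trace Ω).domain) =
        (fun v : (trace Ω).domain => ((v : H1 Ω), (0 : L2Bdry Ω))) ⁻¹'
          ((restrictionGraph Ω).topologicalClosure : Set (H1 Ω × L2Bdry Ω)) := by
      ext v
      have hv : ((v : H1 Ω), trace Ω v) ∈ (restrictionGraph Ω).topologicalClosure :=
        Submodule.mem_graph_toLinearPMap hg v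
      constructor
      · intro h0
        have h0' : trace Ω v = 0 := h0
        rw [h0'] at hv
        exact hv
      · intro h0
        have h1 := (restrictionGraph Ω).topologicalClosure.sub_mem hv h0
        have h2 := hg _ h1 (by simp)
        change trace Ω v = 0
        simpa using h2
    rw [h]
    exact (Submodule.isClosed_topologicalClosure _).preimage
      (continuous_subtype_val.prodMk continuous_const)
  · have h : (trace Ω).toFun = 0 := by
      unfold trace Submodule.toLinearPMap
      exact dif_neg hg
    rw [h, LinearMap.ker_zero]
    exact isClosed_univ

/-- The norm of `H^{1/2}(Γ)` is the quotient norm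
`‖w‖ = inf {‖v‖_{H¹(Ω)} | v ∈ H¹(Ω), γ v = w}`. -/
instance (Ω : Set Plane) : NormedAddCommGroup (HHalf Ω) :=
  NormedAddCommGroup.induced (HHalf Ω) ((trace Ω).domain ⧸ (trace Ω).toFun.ker)
    (HHalf.equivQuot Ω) (HHalf.equivQuot Ω).injective

instance (Ω : Set Plane) : NormedSpace ℝ (HHalf Ω) :=
  NormedSpace.induced ℝ (HHalf Ω) ((trace Ω).domain ⧸ (trace Ω).toFun.ker)
    (HHalf.equivQuot Ω)

/-- The trace as a map from `H¹(Ω)` onto `H^{1/2}(Γ)`. -/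
def traceHalf (Ω : Set Plane) : (trace Ω).domain →ₗ[ℝ] HHalf Ω :=
  (trace Ω).toFun.rangeRestrict

/-- `M = γ(X)`, a subspace of `H^{1/2}(Γ)`, with the norm of `H^{1/2}(Γ)`. -/
def M (Ω Γ₁ : Set Plane) : Submodule ℝ (HHalf Ω) := (X Ω Γ₁).map (traceHalf Ω)

/-- The trace `γ : X → M`. -/
def traceM (Ω Γ₁ : Set Plane) : X Ω Γ₁ →ₗ[ℝ] M Ω Γ₁ := (traceHalf Ω).submoduleMap (X Ω Γ₁)

/-- `Y = M'`, the space of continuous linear functionals on `M`; the duality pairing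
`⟨μ, w⟩_{Y,M}` is the evaluation `μ w`. -/
abbrev Y (Ω Γ₁ : Set Plane) : Type := StrongDual ℝ (M Ω Γ₁)

/-! ### The mixed problem -/

/-- `a(u, v) = ξ (u, v)_X`. -/
def formA {Ω Γ₁ : Set Plane} (ξ : ℝ) (u v : X Ω Γ₁) : ℝ := ξ * innerX u v

/-- `(f, v)_X = ∫_Ω f₀ v dx + ∫_{Γ₂} f₂ γv dΓ`. -/
def load {Ω Γ₁ : Set Plane} (Γ₂ : Set Plane) (f₀ : L2 Ω)
    (f₂ : Lp ℝ 2 ((bdryMeasure Ω).restrict Γ₂)) (v : X Ω Γ₁) : ℝ :=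
  (∫ x in Ω, f₀ x * funOf v.1.1 x) + ∫ x in Γ₂, f₂ x * trace Ω v.1 x ∂(bdryMeasure Ω)

/-- `Λ = {μ ∈ Y | ⟨μ, γv⟩ ≤ ∫_{Γ₃} g |γv| dΓ for all v ∈ X}`. -/
def multipliers (Ω Γ₁ Γ₃ : Set Plane) (g : ℝ) : Set (Y Ω Γ₁) :=
  {μ | ∀ v : X Ω Γ₁, μ (traceM Ω Γ₁ v) ≤ ∫ x in Γ₃, g * |trace Ω v.1 x| ∂(bdryMeasure Ω)}

/-- `(u, lam) ∈ X × Λ` solves the mixed variational formulation: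
`a(u, v) + ⟨lam, γv⟩ = (f, v)_X` for all `v ∈ X`, and `⟨μ - lam, γu⟩ ≤ 0` for all `μ ∈ Λ`. -/
def IsMixedSolution (Ω Γ₁ Γ₂ Γ₃ : Set Plane) (ξ g : ℝ) (f₀ : L2 Ω)
    (f₂ : Lp ℝ 2 ((bdryMeasure Ω).restrict Γ₂)) (u : X Ω Γ₁) (lam : Y Ω Γ₁) : Prop :=
  lam ∈ multipliers Ω Γ₁ Γ₃ g ∧
  (∀ v : X Ω Γ₁, formA ξ u v + lam (traceM Ω Γ₁ v) = load Γ₂ f₀ f₂ v) ∧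
  ∀ μ ∈ multipliers Ω Γ₁ Γ₃ g, (μ - lam) (traceM Ω Γ₁ u) ≤ 0

end AntiplaneContact

end

/-!
The saddle point problem has a direct solution by projection. Write `ℓ(v) = ⟨lam, γv⟩` and let `F`
be the load. The functionals `ℓ` on `X` with `ℓ(v) ≤ j(v) = ∫_{Γ₃} g |γv|` form a closed convex set
`K`; they vanish on `ker γ`, because `j` does, so (as `M` carries the quotient norm of `X / ker γ`)
they are exactly the functionals `⟨μ, γ·⟩` with `μ ∈ Λ`. If `ℓ` is the projection of `F` onto `K`
in the dual of the Hilbert space `(X, (·,·)_X)` and `ξ u` represents `F - ℓ`, then the first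
equation holds by definition, and the second is the variational inequality that characterizes the
projection. Testing two solutions against each other gives uniqueness. This is
`existsUnique_saddle_point`, and it needs neither compactness nor the existence of a minimizer.

What remains is that `(·,·)_X` is a complete inner product on `X` and that the load is bounded.
Both follow from two inequalities for smooth functions `φ` on the plane, which then pass to the
closed graph that defines the trace, so that density of smooth functions in `H¹(Ω)` is not needed:

* the trace inequality `‖φ‖²_{L²(Γ)} ≤ C ‖φ‖²_{H¹(Ω)}` (`traceBoundOn_frontier`). It shows that the
  trace is single valued and bounded with closed domain;
* the Poincaré inequality `‖φ - c‖²_{L²(Ω)} ≤ C ‖∇φ‖²_{L²(Ω)}` for some constant `c`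
  (`poincareOn_self`). Together with the trace inequality and the positive length of `Γ₁` it yields
  `‖φ‖²_{L²(Ω)} ≤ C (‖∇φ‖²_{L²(Ω)} + ‖φ‖²_{L²(Γ₁)})` (`exists_friedrichs_bound`).

Locally, in a region `h(s) < t < T` above a graph, both inequalities come from integrating `∂φ`
along line segments parallel to the axes (`IsBox.poincare_pair`, `IsBox.trace_pair`). The trace
inequality is then globalized by compactness of `Γ`. The Poincaré inequality passes to unions of
overlapping open sets (`PoincareOn.union`); connectedness of `Ω` links any two of its points, and
compactness of the closure leaves finitely many pieces, so Rellich's theorem is not used.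
-/

noncomputable section

namespace AntiplaneContact

/-! ### A saddle point problem in Hilbert space -/

/-- If `M` carries the quotient norm of `γ : V → M`, then the bounded functionals on `V` that vanish
on `ker γ` are induced by bounded functionals on `M`. -/
theorem exists_factor_of_quotient_norm {V M : Type*} [NormedAddCommGroup V] [NormedSpace ℝ V]
    [NormedAddCommGroup M] [NormedSpace ℝ M] {γ : V →L[ℝ] M}
    (hγ : ∀ w : M, ∀ ε > 0, ∃ v, γ v = w ∧ ‖v‖ < ‖w‖ + ε) (l : StrongDual ℝ V)
    (hl : ∀ v, γ v = 0 → l v = 0) : ∃ μ : StrongDual ℝ M, ∀ v, μ (γ v) = l v := by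
  have hsurj : Function.Surjective γ := fun w => by
    obtain ⟨v, hv, -⟩ := hγ w 1 one_pos
    exact ⟨v, hv⟩
  choose σ hσ using hsurj
  have key : ∀ v w, γ v = γ w → l v = l w := fun v w h => by
    have := hl (v - w) (by rw [map_sub, h, sub_self])
    rwa [map_sub, sub_eq_zero] at this
  let m : M →ₗ[ℝ] ℝ :=
    { toFun := fun w => l (σ w)
      map_add' := fun x y => by rw [← map_add]; exact key _ _ (by simp [hσ])
      map_smul' := fun c x => by
        rw [RingHom.id_apply, ← map_smul]; exact key _ _ (by simp [hσ]) }
  refine ⟨m.mkContinuous ‖l‖ fun w => ?_, fun v => key _ _ (hσ _)⟩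
  refine le_of_forall_pos_le_add fun ε hε => ?_
  obtain ⟨v, hv, hvn⟩ := hγ w (ε / (‖l‖ + 1)) (by positivity)
  have h1 : m w = l v := key _ _ (by rw [hσ, hv])
  calc ‖m w‖ ≤ ‖l‖ * ‖v‖ := by rw [h1]; exact l.le_opNorm v
    _ ≤ ‖l‖ * (‖w‖ + ε / (‖l‖ + 1)) := by gcongr
    _ = ‖l‖ * ‖w‖ + ε * (‖l‖ / (‖l‖ + 1)) := by ring
    _ ≤ ‖l‖ * ‖w‖ + ε * 1 := by
        gcongr
        rw [div_le_one (by positivity)]; linarith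
    _ = ‖l‖ * ‖w‖ + ε := by ring

/-- Abstract mixed problem: `V` is a Hilbert space for the inner product `⟪T u, T v⟫`, the space `M`
is a quotient of `V` under `γ`, and the multipliers are bounded by a functional `j` that vanishes on
`ker γ`. The multiplier of the solution is the projection of the load onto the closed convex set of
functionals below `j`; no convexity or continuity of `j` is needed. -/
theorem existsUnique_saddle_point {V M H : Type*} [NormedAddCommGroup V] [NormedSpace ℝ V]
    [CompleteSpace V] [NormedAddCommGroup M] [NormedSpace ℝ M]
    [NormedAddCommGroup H] [InnerProductSpace ℝ H] [CompleteSpace H]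
    (T : V →L[ℝ] H) {C : ℝ} (hT : ∀ v, ‖v‖ ≤ C * ‖T v‖) (γ : V →L[ℝ] M)
    (hγ : ∀ w : M, ∀ ε > 0, ∃ v, γ v = w ∧ ‖v‖ < ‖w‖ + ε)
    {j : V → ℝ} (hj : ∀ v, 0 ≤ j v) (hj0 : ∀ v, γ v = 0 → j v = 0)
    {ξ : ℝ} (hξ : 0 < ξ) (F : StrongDual ℝ V) :
    ∃! p : V × StrongDual ℝ M, (∀ v, p.2 (γ v) ≤ j v) ∧
      (∀ v, ξ * inner ℝ (T p.1) (T v) + p.2 (γ v) = F v) ∧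
      ∀ μ : StrongDual ℝ M, (∀ v, μ (γ v) ≤ j v) → (μ - p.2) (γ p.1) ≤ 0 := by
  have hTinj : ∀ v, T v = 0 → v = 0 := fun v hv => by
    have := hT v
    rw [hv, norm_zero, mul_zero] at this
    simpa using this
  refine existsUnique_of_exists_of_unique ?_ ?_
  swap
  · rintro ⟨u, l⟩ ⟨u', l'⟩ ⟨hl, hu, hlu⟩ ⟨hl', hu', hlu'⟩
    simp only at hl hu hlu hl' hu' hlu'
    -- Each multiplier is admissible in the inequality of the other solution. The sum of the two
    -- inequalities gives `ξ ‖T (u - u')‖² ≤ 0`.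
    have h1 := hlu l' hl'
    have h2 := hlu' l hl
    simp only [sub_apply] at h1 h2
    have h3 := hu (u - u')
    have h4 := hu' (u - u')
    simp only [map_sub, inner_sub_right] at h3 h4
    have h5 : ξ * inner ℝ (T u - T u') (T u - T u') ≤ 0 := by
      simp only [inner_sub_left, inner_sub_right]
      linarith
    have h6 : T (u - u') = 0 := by
      rw [map_sub]
      exact inner_self_eq_zero.1
        (le_antisymm (nonpos_of_mul_nonpos_right h5 hξ) real_inner_self_nonneg)
    have huu : u = u' := sub_eq_zero.1 (hTinj _ h6)
    subst huu
    refine Prod.ext rfl (ContinuousLinearMap.ext fun w => ?_)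
    obtain ⟨v, rfl, -⟩ := hγ w 1 one_pos
    have h7 := hu v
    have h8 := hu' v
    simp only
    linarith
  · have hanti : AntilipschitzWith C.toNNReal T :=
      AddMonoidHomClass.antilipschitz_of_bound T fun v =>
        (hT v).trans (by gcongr; exact Real.le_coe_toNNReal C)
    -- `T` identifies `V` with its range, a closed subspace of `H` and thus a Hilbert space.
    have hcl : IsClosed (T.range : Set H) := hanti.isClosed_range T.uniformContinuous
    have : CompleteSpace T.range := hcl.completeSpace_coe
    let e : V ≃L[ℝ] T.range := ContinuousLinearEquiv.ofBijective
      (T.codRestrict T.range fun v => LinearMap.mem_range_self _ v)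
      (by
        rw [LinearMap.ker_eq_bot']
        intro v hv
        exact hTinj v (congrArg Subtype.val hv))
      (by
        rw [LinearMap.range_eq_top]
        rintro ⟨_, v, rfl⟩
        exact ⟨v, rfl⟩)
    let f : T.range := (InnerProductSpace.toDual ℝ T.range).symm (F ∘L e.symm)
    have hf : ∀ v, inner ℝ f (e v) = F v := fun v => by
      simp [f, InnerProductSpace.toDual_symm_apply]
    -- Riesz representatives of the functionals that lie below `j`.
    let K : Set T.range := {k | ∀ v, inner ℝ k (e v) ≤ j v}
    have hKcl : IsClosed K := by
      simp only [K, ofPred_forall]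
      exact isClosed_iInter fun v => isClosed_le (by fun_prop) continuous_const
    have hKconv : Convex ℝ K := by
      intro x hx y hy s t hs ht hst v
      rw [inner_add_left, inner_smul_left, inner_smul_left]
      simp only [conj_trivial]
      calc s * inner ℝ x (e v) + t * inner ℝ y (e v) ≤ s * j v + t * j v := by
            gcongr
            · exact hx v
            · exact hy v
        _ = j v := by rw [← add_mul, hst, one_mul]
    have hKne : K.Nonempty := ⟨0, fun v => by simpa using hj v⟩
    obtain ⟨l, hlK, hl⟩ := exists_norm_eq_iInf_of_complete_convex hKne hKcl.isComplete hKconv f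
    rw [norm_eq_iInf_iff_real_inner_le_zero hKconv hlK] at hl
    let L : StrongDual ℝ V := (innerSL ℝ l) ∘L (e : V →L[ℝ] T.range)
    have hL : ∀ v, L v = inner ℝ l (e v) := fun v => rfl
    obtain ⟨lam, hlam⟩ := exists_factor_of_quotient_norm hγ L fun v hv => by
      have h1 := hlK v
      have h2 := hlK (-v)
      rw [hj0 _ hv] at h1
      rw [hj0 _ (by rw [map_neg, hv, neg_zero]), map_neg, inner_neg_right] at h2
      rw [hL]; linarith
    let u : V := e.symm (ξ⁻¹ • (f - l))
    have hu : e u = ξ⁻¹ • (f - l) := e.apply_symm_apply _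
    have hin : ∀ v w, inner ℝ (T v) (T w) = inner ℝ (e v) (e w) := fun v w => rfl
    refine ⟨(u, lam), fun v => ?_, fun v => ?_, fun μ hμ => ?_⟩
    · rw [hlam, hL]; exact hlK v
    · simp only
      rw [hlam, hL, hin, hu, inner_smul_left, inner_sub_left, hf]
      simp only [map_inv₀, conj_trivial]
      field_simp
      ring
    · let m : T.range := (InnerProductSpace.toDual ℝ T.range).symm ((μ ∘L γ) ∘L e.symm)
      have hm : ∀ v, inner ℝ m (e v) = μ (γ v) := fun v => by
        simp [m, InnerProductSpace.toDual_symm_apply]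
      have hmK : m ∈ K := fun v => by rw [hm]; exact hμ v
      have h1 := hl m hmK
      simp only [sub_apply]
      rw [hlam, hL, ← hm, ← inner_sub_left, hu, inner_smul_right, real_inner_comm]
      exact mul_nonpos_of_nonneg_of_nonpos (by positivity) h1

/-! ### Estimates above a graph -/

theorem enorm_add_sq_le {E : Type*} [SeminormedAddCommGroup E] (x y : E) :
    ‖x + y‖ₑ ^ 2 ≤ 2 * (‖x‖ₑ ^ 2 + ‖y‖ₑ ^ 2) := by
  simp only [enorm_eq_nnnorm]
  norm_cast
  calc ‖x + y‖₊ ^ 2 ≤ (‖x‖₊ + ‖y‖₊) ^ 2 := by gcongr; exact nnnorm_add_le x y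
    _ ≤ _ := by simpa using add_sq_le (a := ‖x‖₊) (b := ‖y‖₊)

theorem lintegral_enorm_sq_le_measure_mul {α E : Type*} [MeasurableSpace α] [NormedAddCommGroup E]
    {μ : Measure α} {f : α → E} (hf : AEStronglyMeasurable f μ) :
    (∫⁻ x, ‖f x‖ₑ ∂μ) ^ 2 ≤ μ univ * ∫⁻ x, ‖f x‖ₑ ^ 2 ∂μ := by
  have h := eLpNorm_le_eLpNorm_mul_rpow_measure_univ (p := 1) (q := 2) one_le_two hf
  have h2 := eLpNorm_nnreal_pow_eq_lintegral (f := f) (μ := μ) (p := 2) two_ne_zero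
  norm_num at h2
  rw [eLpNorm_one_eq_lintegral_enorm] at h
  norm_num at h
  calc _ ≤ (eLpNorm f 2 μ * μ univ ^ (1 / 2 : ℝ)) ^ 2 := by gcongr
    _ = _ := by
      rw [mul_pow, h2, mul_comm, ← ENNReal.rpow_natCast, ← ENNReal.rpow_mul]
      norm_num

/-- The fundamental theorem of calculus followed by the Cauchy–Schwarz inequality. -/
theorem enorm_sub_sq_le_lintegral_deriv {f f' : ℝ → ℝ} (hf : ∀ t, HasDerivAt f (f' t) t)
    (hf' : Continuous f') {a b x y : ℝ} (hx : x ∈ Icc a b) (hy : y ∈ Icc a b) :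
    ‖f x - f y‖ₑ ^ 2 ≤ ENNReal.ofReal (b - a) * ∫⁻ t in Ioo a b, ‖f' t‖ₑ ^ 2 := by
  wlog hyx : y ≤ x generalizing x y
  · rw [enorm_sub_rev]
    exact this hy hx (le_of_not_ge hyx)
  have h1 : f x - f y = ∫ t in Ioc y x, f' t := by
    rw [← intervalIntegral.integral_of_le hyx]
    exact (intervalIntegral.integral_eq_sub_of_hasDerivAt (fun t _ => hf t)
      (hf'.intervalIntegrable _ _)).symm
  have h2 : ‖f x - f y‖ₑ ≤ ∫⁻ t in Ioo a b, ‖f' t‖ₑ := by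
    rw [h1, Measure.restrict_congr_set (Ioo_ae_eq_Icc (μ := volume))]
    exact (enorm_integral_le_lintegral_enorm _).trans
      (lintegral_mono_set fun t ht => ⟨hy.1.trans ht.1.le, ht.2.trans hx.2⟩)
  calc _ ≤ (∫⁻ t in Ioo a b, ‖f' t‖ₑ) ^ 2 := by gcongr
    _ ≤ _ := by
      simpa using lintegral_enorm_sq_le_measure_mul
        (hf'.aestronglyMeasurable (μ := volume.restrict (Ioo a b)))

theorem lintegral_regionBetween {h k : ℝ → ℝ} {I : Set ℝ} (hh : Measurable h) (hk : Measurable k)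
    (hI : MeasurableSet I) {f : ℝ × ℝ → ℝ≥0∞} (hf : Measurable f) :
    ∫⁻ p in regionBetween h k I, f p = ∫⁻ s in I, ∫⁻ t in Ioo (h s) (k s), f (s, t) := by
  have hD : MeasurableSet (regionBetween h k I) := measurableSet_regionBetween hh hk hI
  rw [← lintegral_indicator hD, Measure.volume_eq_prod,
    lintegral_prod _ (hf.indicator hD).aemeasurable, ← lintegral_indicator hI]
  congr 1 with s
  by_cases hs : s ∈ I
  · rw [indicator_of_mem hs, ← lintegral_indicator measurableSet_Ioo]
    congr 1 with t
    simp [indicator, regionBetween, hs]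
  · rw [indicator_of_notMem hs]
    simp [indicator, regionBetween, hs]

theorem measurable_lintegral_Ioo_section {h k : ℝ → ℝ} (hh : Measurable h) (hk : Measurable k)
    {f : ℝ × ℝ → ℝ≥0∞} (hf : Measurable f) :
    Measurable fun s => ∫⁻ t in Ioo (h s) (k s), f (s, t) := by
  have hD : MeasurableSet (regionBetween h k univ) :=
    measurableSet_regionBetween hh hk MeasurableSet.univ
  convert (hf.indicator hD).lintegral_prod_right' (ν := volume) using 2 with s
  rw [← lintegral_indicator measurableSet_Ioo]
  congr 1 with t
  simp [indicator, regionBetween]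

/-- The graph of `h` over the interval `(a, b)` lies between the heights `m` and `T - η`, so that the
region between the graph and the height `T` contains a rectangle of height `η`. -/
structure IsBox (h : ℝ → ℝ) (a b m η T : ℝ) : Prop where
  cont : Continuous h
  lt : a < b
  pos : 0 < η
  lower : ∀ s ∈ Ioo a b, m ≤ h s
  upper : ∀ s ∈ Ioo a b, h s + η ≤ T

/-- The Poincaré inequality in the region above a graph. A point `(s, t)` is joined to the reference
point by a vertical segment up to the height `t₀ ∈ (T - η, T)` followed by a horizontal one, where
`t₀` is chosen such that the horizontal derivative at this height is at most its average. -/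
theorem IsBox.poincare_pair {h : ℝ → ℝ} {a b m η T : ℝ} (hb : IsBox h a b m η T)
    {F Fs Ft : ℝ × ℝ → ℝ} (hF : Continuous F) (hFs : Continuous Fs) (hFt : Continuous Ft)
    (hs : ∀ s t, HasDerivAt (fun s => F (s, t)) (Fs (s, t)) s)
    (ht : ∀ s t, HasDerivAt (fun t => F (s, t)) (Ft (s, t)) t) :
    ∃ c : ℝ, ∫⁻ p in regionBetween h (fun _ => T) (Ioo a b), ‖F p - c‖ₑ ^ 2 ≤
      2 * ENNReal.ofReal (T - m) ^ 2 *
        (∫⁻ p in regionBetween h (fun _ => T) (Ioo a b), ‖Ft p‖ₑ ^ 2) +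
      2 * ENNReal.ofReal (b - a) ^ 2 * ENNReal.ofReal (T - m) / ENNReal.ofReal η *
        (∫⁻ p in regionBetween h (fun _ => T) (Ioo a b), ‖Fs p‖ₑ ^ 2) := by
  have hmeas : Measurable fun p => ‖Fs p‖ₑ ^ 2 := by fun_prop
  have hmeas' : Measurable fun p => ‖Ft p‖ₑ ^ 2 := by fun_prop
  have hmeasF : ∀ c : ℝ, Measurable fun p => ‖F p - c‖ₑ ^ 2 := fun c => by fun_prop
  have hA : Measurable fun s => ∫⁻ t in Ioo (h s) T, ‖Ft (s, t)‖ₑ ^ 2 :=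
    measurable_lintegral_Ioo_section hb.cont.measurable measurable_const hmeas'
  simp_rw [lintegral_regionBetween hb.cont.measurable measurable_const measurableSet_Ioo hmeas,
    lintegral_regionBetween hb.cont.measurable measurable_const measurableSet_Ioo hmeas',
    fun c => lintegral_regionBetween hb.cont.measurable (measurable_const (a := T))
      (measurableSet_Ioo (a := a) (b := b)) (hmeasF c)]
  set A := fun s => ∫⁻ t in Ioo (h s) T, ‖Ft (s, t)‖ₑ ^ 2
  set B := fun t => ∫⁻ s in Ioo a b, ‖Fs (s, t)‖ₑ ^ 2 with hB
  have hBm : Measurable B := hmeas.lintegral_prod_left' (μ := volume.restrict (Ioo a b))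
  have hη := hb.pos
  obtain ⟨t₀, ht₀, hBt⟩ := exists_le_setLAverage (μ := volume) (s := Ioo (T - η) T) (f := B)
    (by simp [hη]) (by simp) hBm.aemeasurable
  have hBt₀ : B t₀ ≤ (∫⁻ s in Ioo a b, ∫⁻ t in Ioo (h s) T, ‖Fs (s, t)‖ₑ ^ 2) /
      ENNReal.ofReal η := by
    refine hBt.trans ?_
    rw [setLAverage_eq, Real.volume_Ioo, sub_sub_cancel, hB,
      lintegral_lintegral_swap (f := fun t s => ‖Fs (s, t)‖ₑ ^ 2)
        (hmeas.comp measurable_swap).aemeasurable]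
    gcongr ?_ / _
    refine setLIntegral_mono' measurableSet_Ioo fun s hs => lintegral_mono_set ?_
    exact Ioo_subset_Ioo_left (by have := hb.upper s hs; linarith)
  have hmid : (a + b) / 2 ∈ Icc a b := by
    have := hb.lt
    constructor <;> linarith
  refine ⟨F ((a + b) / 2, t₀), ?_⟩
  have hpt : ∀ s ∈ Ioo a b, ∫⁻ t in Ioo (h s) T, ‖F (s, t) - F ((a + b) / 2, t₀)‖ₑ ^ 2 ≤
      2 * ENNReal.ofReal (T - m) ^ 2 * A s +
        2 * ENNReal.ofReal (T - m) * ENNReal.ofReal (b - a) * B t₀ := by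
    intro s hsI
    have hm := hb.lower s hsI
    have hT := hb.upper s hsI
    have ht₀' : t₀ ∈ Icc (h s) T := ⟨by linarith [ht₀.1], ht₀.2.le⟩
    calc ∫⁻ t in Ioo (h s) T, ‖F (s, t) - F ((a + b) / 2, t₀)‖ₑ ^ 2
        ≤ ∫⁻ t in Ioo (h s) T, 2 * (ENNReal.ofReal (T - m) * A s +
            ENNReal.ofReal (b - a) * B t₀) := by
          refine setLIntegral_mono' measurableSet_Ioo fun t htI => ?_
          have e : F (s, t) - F ((a + b) / 2, t₀) =
            (F (s, t) - F (s, t₀)) + (F (s, t₀) - F ((a + b) / 2, t₀)) := by ring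
          rw [e]
          refine (enorm_add_sq_le _ _).trans ?_
          gcongr
          · refine (enorm_sub_sq_le_lintegral_deriv (ht s) (by fun_prop)
              (Ioo_subset_Icc_self htI) ht₀').trans ?_
            gcongr
          · exact enorm_sub_sq_le_lintegral_deriv (fun s => hs s t₀) (by fun_prop)
              (Ioo_subset_Icc_self hsI) hmid
      _ = 2 * (ENNReal.ofReal (T - m) * A s + ENNReal.ofReal (b - a) * B t₀) *
            ENNReal.ofReal (T - h s) := by
          rw [setLIntegral_const, Real.volume_Ioo]
      _ ≤ 2 * (ENNReal.ofReal (T - m) * A s + ENNReal.ofReal (b - a) * B t₀) *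
            ENNReal.ofReal (T - m) := by gcongr
      _ = _ := by ring
  calc _ ≤ ∫⁻ s in Ioo a b, (2 * ENNReal.ofReal (T - m) ^ 2 * A s +
        2 * ENNReal.ofReal (T - m) * ENNReal.ofReal (b - a) * B t₀) :=
        setLIntegral_mono' measurableSet_Ioo hpt
    _ = 2 * ENNReal.ofReal (T - m) ^ 2 * (∫⁻ s in Ioo a b, A s) +
        2 * ENNReal.ofReal (T - m) * ENNReal.ofReal (b - a) * B t₀ * ENNReal.ofReal (b - a) := by
        rw [lintegral_add_right _ measurable_const, lintegral_const_mul _ hA, setLIntegral_const,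
          Real.volume_Ioo]
    _ ≤ 2 * ENNReal.ofReal (T - m) ^ 2 * (∫⁻ s in Ioo a b, A s) +
        2 * ENNReal.ofReal (T - m) * ENNReal.ofReal (b - a) *
          ((∫⁻ s in Ioo a b, ∫⁻ t in Ioo (h s) T, ‖Fs (s, t)‖ₑ ^ 2) / ENNReal.ofReal η) *
            ENNReal.ofReal (b - a) := by gcongr
    _ = _ := by
        simp only [div_eq_mul_inv]
        ring

/-- The trace inequality on a graph: the value on the graph is compared along vertical segments with
the values above it, and the result is averaged over a height of at least `η`. -/
theorem IsBox.trace_pair {h : ℝ → ℝ} {a b m η T : ℝ} (hb : IsBox h a b m η T)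
    {F Ft : ℝ × ℝ → ℝ} (hF : Continuous F) (hFt : Continuous Ft)
    (ht : ∀ s t, HasDerivAt (fun t => F (s, t)) (Ft (s, t)) t) :
    ENNReal.ofReal η * ∫⁻ s in Ioo a b, ‖F (s, h s)‖ₑ ^ 2 ≤
      2 * (∫⁻ p in regionBetween h (fun _ => T) (Ioo a b), ‖F p‖ₑ ^ 2) +
      2 * ENNReal.ofReal (T - m) ^ 2 *
        (∫⁻ p in regionBetween h (fun _ => T) (Ioo a b), ‖Ft p‖ₑ ^ 2) := by
  have hmeas : Measurable fun p => ‖F p‖ₑ ^ 2 := by fun_prop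
  have hmeas' : Measurable fun p => ‖Ft p‖ₑ ^ 2 := by fun_prop
  have hA : Measurable fun s => ∫⁻ t in Ioo (h s) T, ‖Ft (s, t)‖ₑ ^ 2 :=
    measurable_lintegral_Ioo_section hb.cont.measurable measurable_const hmeas'
  rw [lintegral_regionBetween hb.cont.measurable measurable_const measurableSet_Ioo hmeas,
    lintegral_regionBetween hb.cont.measurable measurable_const measurableSet_Ioo hmeas',
    ← lintegral_const_mul' _ _ (by finiteness), ← lintegral_const_mul' _ _ (by finiteness),
    ← lintegral_const_mul' _ _ (by finiteness), ← lintegral_add_right _ (hA.const_mul _)]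
  set A := fun s => ∫⁻ t in Ioo (h s) T, ‖Ft (s, t)‖ₑ ^ 2
  refine setLIntegral_mono' measurableSet_Ioo fun s hs => ?_
  have hm := hb.lower s hs
  have hT := hb.upper s hs
  have hη := hb.pos
  calc ENNReal.ofReal η * ‖F (s, h s)‖ₑ ^ 2
      ≤ ENNReal.ofReal (T - h s) * ‖F (s, h s)‖ₑ ^ 2 := by gcongr; linarith
    _ = ∫⁻ t in Ioo (h s) T, ‖F (s, h s)‖ₑ ^ 2 := by
        rw [setLIntegral_const, Real.volume_Ioo, mul_comm]
    _ ≤ ∫⁻ t in Ioo (h s) T, (2 * ‖F (s, t)‖ₑ ^ 2 + 2 * ENNReal.ofReal (T - m) * A s) := by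
        refine setLIntegral_mono' measurableSet_Ioo fun t htI => ?_
        have e : F (s, h s) = F (s, t) + (F (s, h s) - F (s, t)) := by ring
        rw [e, mul_assoc, ← mul_add]
        refine (enorm_add_sq_le _ _).trans ?_
        gcongr
        refine (enorm_sub_sq_le_lintegral_deriv (ht s) (by fun_prop)
          (left_mem_Icc.2 (by linarith)) (Ioo_subset_Icc_self htI)).trans ?_
        gcongr
    _ = 2 * (∫⁻ t in Ioo (h s) T, ‖F (s, t)‖ₑ ^ 2) +
          2 * ENNReal.ofReal (T - m) * A s * ENNReal.ofReal (T - h s) := by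
        rw [lintegral_add_right _ measurable_const, lintegral_const_mul' _ _ (by finiteness),
          setLIntegral_const, Real.volume_Ioo]
    _ ≤ 2 * (∫⁻ t in Ioo (h s) T, ‖F (s, t)‖ₑ ^ 2) +
          2 * ENNReal.ofReal (T - m) * A s * ENNReal.ofReal (T - m) := by gcongr
    _ = _ := by ring

/-! ### Charts of the domain -/

/-- The point with coordinates `p` in the rotated axes given by `L`; inverse to `coords L`. -/
def pointAt (L : Plane ≃ₗᵢ[ℝ] Plane) (p : ℝ × ℝ) : Plane :=
  p.1 • L.symm (EuclideanSpace.single 0 1) + p.2 • L.symm (EuclideanSpace.single 1 1)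

/-- The coordinates of `y` in the rotated axes given by `L`. -/
def coords (L : Plane ≃ₗᵢ[ℝ] Plane) (y : Plane) : ℝ × ℝ := (L y 0, L y 1)

theorem coords_pointAt (L : Plane ≃ₗᵢ[ℝ] Plane) (p : ℝ × ℝ) : coords L (pointAt L p) = p := by
  simp [coords, pointAt]

theorem pointAt_coords (L : Plane ≃ₗᵢ[ℝ] Plane) (y : Plane) : pointAt L (coords L y) = y := by
  apply L.injective
  ext i
  fin_cases i <;> simp [coords, pointAt]

theorem continuous_pointAt (L : Plane ≃ₗᵢ[ℝ] Plane) : Continuous (pointAt L) := by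
  unfold pointAt; fun_prop

theorem continuous_coords (L : Plane ≃ₗᵢ[ℝ] Plane) : Continuous (coords L) := by
  unfold coords; fun_prop

theorem dist_pointAt_le (L : Plane ≃ₗᵢ[ℝ] Plane) (p q : ℝ × ℝ) :
    dist (pointAt L p) (pointAt L q) ≤ |p.1 - q.1| + |p.2 - q.2| := by
  have h : pointAt L p - pointAt L q = (p.1 - q.1) • L.symm (EuclideanSpace.single 0 1) +
      (p.2 - q.2) • L.symm (EuclideanSpace.single 1 1) := by
    simp only [pointAt, sub_smul]; abel
  rw [dist_eq_norm, h]
  refine (norm_add_le _ _).trans ?_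
  simp [norm_smul]

theorem abs_coord_sub_le (L : Plane ≃ₗᵢ[ℝ] Plane) (x y : Plane) (i : Fin 2) :
    |L y i - L x i| ≤ dist y x := by
  have h := PiLp.norm_apply_le (L (y - x)) i
  rw [L.norm_map, ← dist_eq_norm] at h
  simpa using h

theorem measurePreserving_coords (L : Plane ≃ₗᵢ[ℝ] Plane) :
    MeasurePreserving (coords L) volume volume :=
  (volume_preserving_finTwoArrow ℝ).comp
    ((EuclideanSpace.volume_preserving_symm_measurableEquiv_toLp (Fin 2)).comp L.measurePreserving)

theorem setLIntegral_coords_preimage (L : Plane ≃ₗᵢ[ℝ] Plane) (f : Plane → ℝ≥0∞)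
    (D : Set (ℝ × ℝ)) :
    ∫⁻ y in coords L ⁻¹' D, f y = ∫⁻ p in D, f (pointAt L p) := by
  let e : Plane ≃ₜ ℝ × ℝ :=
    { toFun := coords L
      invFun := pointAt L
      left_inv := pointAt_coords L
      right_inv := coords_pointAt L
      continuous_toFun := continuous_coords L
      continuous_invFun := continuous_pointAt L }
  rw [← (measurePreserving_coords L).setLIntegral_comp_preimage_emb e.measurableEmbedding]
  simp only [pointAt_coords]

/-- Smooth functions deviate from a constant on `U` by no more than their gradient on `Ω`, in the
`L²` sense. The gradient is integrated over all of `Ω`, which makes the notion stable under finite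
overlapping unions. -/
def PoincareOn (Ω U : Set Plane) : Prop :=
  ∃ C : ℝ≥0∞, C ≠ ⊤ ∧ ∀ φ : Plane → ℝ, ContDiff ℝ 1 φ → ∃ c : ℝ,
    ∫⁻ x in U, ‖φ x - c‖ₑ ^ 2 ≤ C * ∫⁻ x in Ω, ‖fderiv ℝ φ x‖ₑ ^ 2

/-- On `S`, with arc length, the `L²` norm of smooth functions is controlled by their `H¹(Ω)` norm. -/
def TraceBoundOn (Ω S : Set Plane) : Prop :=
  ∃ C : ℝ≥0∞, C ≠ ⊤ ∧ ∀ φ : Plane → ℝ, ContDiff ℝ 1 φ →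
    ∫⁻ x in S, ‖φ x‖ₑ ^ 2 ∂(Measure.hausdorffMeasure 1) ≤
      C * ((∫⁻ x in Ω, ‖φ x‖ₑ ^ 2) + ∫⁻ x in Ω, ‖fderiv ℝ φ x‖ₑ ^ 2)

theorem hasDerivAt_comp_pointAt_fst (L : Plane ≃ₗᵢ[ℝ] Plane) {φ : Plane → ℝ}
    (hφ : ContDiff ℝ 1 φ) (s t : ℝ) :
    HasDerivAt (fun s => φ (pointAt L (s, t)))
      (fderiv ℝ φ (pointAt L (s, t)) (L.symm (EuclideanSpace.single 0 1))) s := by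
  refine (hφ.differentiable one_ne_zero _).hasFDerivAt.comp_hasDerivAt s ?_
  have := ((hasDerivAt_id s).smul_const (L.symm (EuclideanSpace.single 0 1))).add_const
    (t • L.symm (EuclideanSpace.single 1 1))
  simpa [pointAt] using this

theorem hasDerivAt_comp_pointAt_snd (L : Plane ≃ₗᵢ[ℝ] Plane) {φ : Plane → ℝ}
    (hφ : ContDiff ℝ 1 φ) (s t : ℝ) :
    HasDerivAt (fun t => φ (pointAt L (s, t)))
      (fderiv ℝ φ (pointAt L (s, t)) (L.symm (EuclideanSpace.single 1 1))) t := by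
  refine (hφ.differentiable one_ne_zero _).hasFDerivAt.comp_hasDerivAt t ?_
  have := ((hasDerivAt_id t).smul_const (L.symm (EuclideanSpace.single 1 1))).const_add
    (s • L.symm (EuclideanSpace.single 0 1))
  simpa [pointAt] using this

theorem enorm_apply_single_le (L : Plane ≃ₗᵢ[ℝ] Plane) (A : Plane →L[ℝ] ℝ) (i : Fin 2) :
    ‖A (L.symm (EuclideanSpace.single i 1))‖ₑ ≤ ‖A‖ₑ := by
  refine enorm_le_iff_norm_le.2 ((A.le_opNorm _).trans ?_)
  simp

theorem continuous_fderiv_pointAt (L : Plane ≃ₗᵢ[ℝ] Plane) {φ : Plane → ℝ} (hφ : ContDiff ℝ 1 φ)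
    (v : Plane) : Continuous fun p => fderiv ℝ φ (pointAt L p) v :=
  ((hφ.continuous_fderiv one_ne_zero).comp (continuous_pointAt L)).clm_apply continuous_const

/-- The points whose coordinates in the axes given by `L` lie above the graph of `h` over `(a, b)` and
below the height `T`. -/
def graphBox (L : Plane ≃ₗᵢ[ℝ] Plane) (h : ℝ → ℝ) (a b T : ℝ) : Set Plane :=
  coords L ⁻¹' regionBetween h (fun _ => T) (Ioo a b)

theorem lintegral_regionBetween_fderiv_le {Ω : Set Plane} (L : Plane ≃ₗᵢ[ℝ] Plane) {h : ℝ → ℝ}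
    {a b T : ℝ} (hΩ : graphBox L h a b T ⊆ Ω) (φ : Plane → ℝ) (i : Fin 2) :
    ∫⁻ p in regionBetween h (fun _ => T) (Ioo a b),
      ‖fderiv ℝ φ (pointAt L p) (L.symm (EuclideanSpace.single i 1))‖ₑ ^ 2 ≤
      ∫⁻ x in Ω, ‖fderiv ℝ φ x‖ₑ ^ 2 := by
  refine le_trans ?_ (lintegral_mono_set hΩ)
  rw [graphBox, setLIntegral_coords_preimage]
  gcongr
  exact enorm_apply_single_le L _ i

theorem IsBox.poincareOn {Ω : Set Plane} {h : ℝ → ℝ} {a b m η T : ℝ} (hb : IsBox h a b m η T)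
    (L : Plane ≃ₗᵢ[ℝ] Plane) (hΩ : graphBox L h a b T ⊆ Ω) :
    PoincareOn Ω (graphBox L h a b T) := by
  refine ⟨2 * ENNReal.ofReal (T - m) ^ 2 +
    2 * ENNReal.ofReal (b - a) ^ 2 * ENNReal.ofReal (T - m) / ENNReal.ofReal η, ?_,
    fun φ hφ => ?_⟩
  · have := hb.pos
    exact ENNReal.add_ne_top.2 ⟨by finiteness, ENNReal.div_ne_top (by finiteness) (by simpa)⟩
  obtain ⟨c, hc⟩ := hb.poincare_pair (hφ.continuous.comp (continuous_pointAt L))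
    (continuous_fderiv_pointAt L hφ _) (continuous_fderiv_pointAt L hφ _)
    (hasDerivAt_comp_pointAt_fst L hφ) (hasDerivAt_comp_pointAt_snd L hφ)
  refine ⟨c, ?_⟩
  rw [add_mul]
  refine le_trans (le_of_eq ?_) (hc.trans ?_)
  · rw [graphBox, setLIntegral_coords_preimage]
    rfl
  · gcongr
    · exact lintegral_regionBetween_fderiv_le L hΩ φ 1
    · exact lintegral_regionBetween_fderiv_le L hΩ φ 0

/-- Arc length on a Lipschitz curve is at most the Lipschitz constant times the parameter length. -/
theorem setLIntegral_hausdorff_image_le {κ : ℝ → Plane} {K : NNReal} {I : Set ℝ}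
    (hκ : Continuous κ) (hL : LipschitzOnWith K κ I) {f : Plane → ℝ≥0∞}
    (hf : Measurable f) :
    ∫⁻ x in κ '' I, f x ∂(Measure.hausdorffMeasure 1) ≤ K * ∫⁻ s in I, f (κ s) := by
  have hle : (Measure.hausdorffMeasure 1 : Measure Plane).restrict (κ '' I) ≤
      (K : ℝ≥0∞) • (volume.restrict I).map κ := by
    refine Measure.le_iff.2 fun A hA => ?_
    rw [Measure.restrict_apply hA, Measure.smul_apply, Measure.map_apply hκ.measurable hA,
      Measure.restrict_apply (hκ.measurable hA), inter_comm A, ← image_inter_preimage,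
      inter_comm I, smul_eq_mul, ← hausdorffMeasure_real]
    simpa using (hL.mono inter_subset_right).hausdorffMeasure_image_le zero_le_one
  refine (lintegral_mono' hle le_rfl).trans ?_
  rw [lintegral_smul_measure, lintegral_map hf hκ.measurable, smul_eq_mul]

theorem IsBox.traceBoundOn {Ω S : Set Plane} {h : ℝ → ℝ} {a b m η T : ℝ}
    (hb : IsBox h a b m η T) (L : Plane ≃ₗᵢ[ℝ] Plane) (hΩ : graphBox L h a b T ⊆ Ω)
    {K : NNReal} (hK : LipschitzOnWith K h (Ioo a b))
    (hS : ∀ y ∈ S, L y 0 ∈ Ioo a b ∧ L y 1 = h (L y 0)) :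
    TraceBoundOn Ω S := by
  have hη := hb.pos
  let κ : ℝ → Plane := fun s => pointAt L (s, h s)
  have hκ : Continuous κ := (continuous_pointAt L).comp (continuous_id.prodMk hb.cont)
  have hκL : LipschitzOnWith (1 + K) κ (Ioo a b) := by
    refine LipschitzOnWith.of_dist_le_mul fun s hs s' hs' => (dist_pointAt_le L _ _).trans ?_
    have := hK.dist_le_mul s hs s' hs'
    rw [Real.dist_eq, Real.dist_eq] at this
    rw [Real.dist_eq]
    push_cast
    linarith
  have hSκ : S ⊆ κ '' Ioo a b := fun y hy => by
    obtain ⟨h0, h1⟩ := hS y hy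
    refine ⟨L y 0, h0, ?_⟩
    simp only [κ]
    rw [← h1]
    exact pointAt_coords L y
  refine ⟨((1 + K : NNReal) : ℝ≥0∞) *
    ((2 + 2 * ENNReal.ofReal (T - m) ^ 2) / ENNReal.ofReal η), ?_, fun φ hφ => ?_⟩
  · exact ENNReal.mul_ne_top (by finiteness) (ENNReal.div_ne_top (by finiteness) (by simpa))
  have hc := hφ.continuous
  refine (lintegral_mono_set hSκ).trans ((setLIntegral_hausdorff_image_le hκ
    hκL (by fun_prop)).trans ?_)
  rw [mul_assoc]
  gcongr
  have h1 := hb.trace_pair (hφ.continuous.comp (continuous_pointAt L))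
    (continuous_fderiv_pointAt L hφ _) (hasDerivAt_comp_pointAt_snd L hφ)
  have h2 : ∫⁻ p in regionBetween h (fun _ => T) (Ioo a b), ‖(φ ∘ pointAt L) p‖ₑ ^ 2 ≤
      ∫⁻ x in Ω, ‖φ x‖ₑ ^ 2 := by
    refine le_trans (le_of_eq ?_) (lintegral_mono_set hΩ)
    rw [graphBox, setLIntegral_coords_preimage]
    rfl
  have h3 := lintegral_regionBetween_fderiv_le L hΩ φ 1
  rw [← ENNReal.mul_div_right_comm, ENNReal.le_div_iff_mul_le (by simp [hη]) (by simp), mul_comm]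
  refine h1.trans ?_
  calc _ ≤ 2 * (∫⁻ x in Ω, ‖φ x‖ₑ ^ 2) +
        2 * ENNReal.ofReal (T - m) ^ 2 * ∫⁻ x in Ω, ‖fderiv ℝ φ x‖ₑ ^ 2 := by gcongr
    _ ≤ (2 + 2 * ENNReal.ofReal (T - m) ^ 2) * (∫⁻ x in Ω, ‖φ x‖ₑ ^ 2) +
        (2 + 2 * ENNReal.ofReal (T - m) ^ 2) * ∫⁻ x in Ω, ‖fderiv ℝ φ x‖ₑ ^ 2 := by
      gcongr
      · exact le_self_add
      · exact le_add_self
    _ = _ := by rw [mul_add]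

theorem isOpen_graphBox (L : Plane ≃ₗᵢ[ℝ] Plane) {h : ℝ → ℝ} (hh : Continuous h) (a b T : ℝ) :
    IsOpen (graphBox L h a b T) := by
  refine IsOpen.preimage (continuous_coords L) ?_
  simp only [regionBetween, mem_Ioo, ofPred_and]
  refine ((isOpen_lt continuous_const continuous_fst).inter
    (isOpen_lt continuous_fst continuous_const)).inter
    ((isOpen_lt (hh.comp continuous_fst) continuous_snd).inter
      (isOpen_lt continuous_snd continuous_const))

/-- Near an interior point, `Ω` contains a square. -/
theorem exists_graphBox_of_mem {Ω : Set Plane} (hΩ : IsOpen Ω) {x : Plane} (hx : x ∈ Ω) :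
    ∃ U, IsOpen U ∧ U ⊆ Ω ∧ PoincareOn Ω U ∧ ∃ ρ > 0, ball x ρ ⊆ U := by
  obtain ⟨r, hr, hball⟩ := Metric.isOpen_iff.1 hΩ x hx
  let L := LinearIsometryEquiv.refl ℝ Plane
  let c := x 1 - r / 2
  have hb : IsBox (fun _ => c) (x 0 - r / 2) (x 0 + r / 2) c r (x 1 + r / 2) :=
    ⟨continuous_const, by linarith, hr, fun _ _ => le_rfl, fun _ _ => by simp only [c]; linarith⟩
  have hsub : graphBox L (fun _ => c) (x 0 - r / 2) (x 0 + r / 2) (x 1 + r / 2) ⊆ Ω := by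
    rintro y ⟨⟨h1, h2⟩, h3, h4⟩
    apply hball
    have := dist_pointAt_le L (coords L y) (coords L x)
    rw [pointAt_coords, pointAt_coords] at this
    refine mem_ball.2 (this.trans_lt ?_)
    simp only [coords, L, LinearIsometryEquiv.coe_refl, id, c] at h1 h2 h3 h4 ⊢
    have h5 : |y 0 - x 0| < r / 2 := abs_lt.2 ⟨by linarith, by linarith⟩
    have h6 : |y 1 - x 1| < r / 2 := abs_lt.2 ⟨by linarith, by linarith⟩
    linarith
  refine ⟨_, isOpen_graphBox L continuous_const _ _ _, hsub, hb.poincareOn L hsub, r / 2,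
    by positivity, fun y hy => ?_⟩
  have h0 := (abs_coord_sub_le L x y 0).trans_lt hy
  have h1 := (abs_coord_sub_le L x y 1).trans_lt hy
  simp only [L, LinearIsometryEquiv.coe_refl, id, abs_lt] at h0 h1
  simp only [graphBox, regionBetween, coords, L, mem_preimage, mem_ofPred_eq,
    LinearIsometryEquiv.coe_refl, id, mem_Ioo, c]
  refine ⟨⟨?_, ?_⟩, ?_, ?_⟩ <;> linarith

/-- Where `Ω` is the region above a graph, its boundary is contained in the graph. -/
theorem eq_of_mem_frontier_of_epigraph {Ω : Set Plane} (hΩ : IsOpen Ω) {L : Plane ≃ₗᵢ[ℝ] Plane}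
    {h : ℝ → ℝ} (hh : Continuous h) {x : Plane} {r : ℝ}
    (hxr : ∀ y ∈ ball x r, (y ∈ Ω ↔ h (L y 0) < L y 1)) {y : Plane} (hy : y ∈ ball x r)
    (hyf : y ∈ frontier Ω) : L y 1 = h (L y 0) := by
  rw [hΩ.frontier_eq] at hyf
  refine le_antisymm (not_lt.1 fun hlt => hyf.2 ((hxr y hy).2 hlt)) (not_lt.1 fun hlt => ?_)
  have hopen : IsOpen ({z | L z 1 < h (L z 0)} ∩ ball x r) :=
    (isOpen_lt (by fun_prop) (hh.comp (by fun_prop))).inter isOpen_ball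
  obtain ⟨z, ⟨hz1, hz2⟩, hz3⟩ := mem_closure_iff.1 hyf.1 _ hopen ⟨hlt, hy⟩
  exact lt_asymm hz1 ((hxr z hz2).1 hz3)

/-- Near a boundary point, `Ω` coincides with a region above a graph on which the local Poincaré and
trace inequalities hold. -/
theorem exists_graphBox_of_mem_frontier {Ω : Set Plane} (hΩ : IsOpen Ω) (hbd : HasC1Boundary Ω)
    {x : Plane} (hx : x ∈ frontier Ω) :
    ∃ U, IsOpen U ∧ U ⊆ Ω ∧ PoincareOn Ω U ∧ ∃ ρ > 0, ball x ρ ∩ Ω ⊆ U ∧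
      TraceBoundOn Ω (ball x ρ ∩ frontier Ω) := by
  obtain ⟨L, h, r, hh, hr, hxr⟩ := hbd x hx
  have hx1 := eq_of_mem_frontier_of_epigraph hΩ hh.continuous hxr (mem_ball_self hr) hx
  obtain ⟨δ₀, hδ₀, hcont⟩ := Metric.continuous_iff.1 hh.continuous (L x 0) (r / 4) (by positivity)
  -- The points with `|s - L x 0| < r / 4` and `|t - L x 1| < r / 2` lie in the ball of radius `r`
  -- about `x`, while the graph stays within `r / 4` of the height `L x 1`.
  let δ := min δ₀ (r / 4)
  have hδ : 0 < δ := by positivity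
  have hδr : δ ≤ r / 4 := min_le_right _ _
  have hosc : ∀ s ∈ Ioo (L x 0 - δ) (L x 0 + δ), |h s - L x 1| < r / 4 := fun s hs => by
    rw [hx1]
    refine hcont s ?_
    rw [Real.dist_eq, abs_lt]
    have : δ ≤ δ₀ := min_le_left _ _
    constructor <;> linarith [hs.1, hs.2]
  have hb : IsBox h (L x 0 - δ) (L x 0 + δ) (L x 1 - r / 4) (r / 4) (L x 1 + r / 2) := by
    refine ⟨hh.continuous, by linarith, by positivity, fun s hs => ?_, fun s hs => ?_⟩ <;>
    · have := abs_lt.1 (hosc s hs)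
      linarith
  have hsub : graphBox L h (L x 0 - δ) (L x 0 + δ) (L x 1 + r / 2) ⊆ Ω := by
    rintro y ⟨h12, h3, h4⟩
    have h5 := abs_lt.1 (hosc _ h12)
    simp only [coords, mem_Ioo] at h12 h3 h4 h5
    have h6 : |L y 0 - L x 0| < r / 4 := abs_lt.2 ⟨by linarith, by linarith⟩
    have h7 : |L y 1 - L x 1| < r / 2 := abs_lt.2 ⟨by linarith, by linarith⟩
    refine (hxr y (mem_ball.2 ?_)).2 h3
    have := dist_pointAt_le L (coords L y) (coords L x)
    rw [pointAt_coords, pointAt_coords] at this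
    refine this.trans_lt ?_
    simp only [coords]
    linarith
  obtain ⟨K, hK⟩ := hh.contDiffOn.exists_lipschitzOnWith one_ne_zero
    (convex_Icc (L x 0 - δ) (L x 0 + δ)) isCompact_Icc
  have hcoord : ∀ y ∈ ball x δ, L y 0 ∈ Ioo (L x 0 - δ) (L x 0 + δ) ∧ L y 1 < L x 1 + r / 2 ∧
      y ∈ ball x r := fun y hy => by
    have h0 := abs_lt.1 ((abs_coord_sub_le L x y 0).trans_lt hy)
    have h1 := abs_lt.1 ((abs_coord_sub_le L x y 1).trans_lt hy)
    exact ⟨⟨by linarith, by linarith⟩, by linarith, ball_subset_ball (by linarith) hy⟩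
  refine ⟨_, isOpen_graphBox L hh.continuous _ _ _, hsub, hb.poincareOn L hsub, δ, hδ, ?_,
    hb.traceBoundOn L hsub (hK.mono Ioo_subset_Icc_self) ?_⟩
  · rintro y ⟨hy, hyΩ⟩
    obtain ⟨h0, h1, h2⟩ := hcoord y hy
    exact ⟨h0, (hxr y h2).1 hyΩ, h1⟩
  · rintro y ⟨hy, hyf⟩
    obtain ⟨h0, h1, h2⟩ := hcoord y hy
    exact ⟨h0, eq_of_mem_frontier_of_epigraph hΩ hh.continuous hxr h2 hyf⟩

/-! ### The Poincaré and trace inequalities on the whole domain -/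

theorem TraceBoundOn.mono {Ω S S' : Set Plane} (h : TraceBoundOn Ω S) (hS : S' ⊆ S) :
    TraceBoundOn Ω S' := by
  obtain ⟨C, hC, h⟩ := h
  exact ⟨C, hC, fun φ hφ => (lintegral_mono_set hS).trans (h φ hφ)⟩

theorem TraceBoundOn.union {Ω S S' : Set Plane} (h : TraceBoundOn Ω S) (h' : TraceBoundOn Ω S') :
    TraceBoundOn Ω (S ∪ S') := by
  obtain ⟨C, hC, h⟩ := h
  obtain ⟨C', hC', h'⟩ := h'
  refine ⟨C + C', by finiteness, fun φ hφ => (lintegral_union_le _ _ _).trans ?_⟩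
  rw [add_mul]
  exact add_le_add (h φ hφ) (h' φ hφ)

/-- The **trace inequality** for smooth functions. -/
theorem traceBoundOn_frontier {Ω : Set Plane} (hΩ : IsOpen Ω) (hbdd : Bornology.IsBounded Ω)
    (hbd : HasC1Boundary Ω) : TraceBoundOn Ω (frontier Ω) := by
  have hcomp : IsCompact (frontier Ω) :=
    hbdd.isCompact_closure.of_isClosed_subset isClosed_frontier frontier_subset_closure
  refine hcomp.induction_on (p := TraceBoundOn Ω) ⟨0, by simp, by simp⟩
    (fun S S' hS h => h.mono hS) (fun S S' h h' => h.union h') fun x hx => ?_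
  obtain ⟨U, -, -, -, ρ, hρ, -, h⟩ := exists_graphBox_of_mem_frontier hΩ hbd hx
  exact ⟨_, Filter.inter_mem (mem_nhdsWithin_of_mem_nhds (ball_mem_nhds x hρ)) self_mem_nhdsWithin, h⟩

theorem PoincareOn.mono {Ω U U' : Set Plane} (h : PoincareOn Ω U) (hU : U' ⊆ U) :
    PoincareOn Ω U' := by
  obtain ⟨C, hC, h⟩ := h
  refine ⟨C, hC, fun φ hφ => ?_⟩
  obtain ⟨c, hc⟩ := h φ hφ
  exact ⟨c, (lintegral_mono_set hU).trans hc⟩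

theorem setLIntegral_enorm_sub_sq_le {A : Set Plane} (φ : Plane → ℝ) (c d : ℝ) :
    ∫⁻ x in A, ‖φ x - c‖ₑ ^ 2 ≤
      2 * ((∫⁻ x in A, ‖φ x - d‖ₑ ^ 2) + volume A * ‖d - c‖ₑ ^ 2) := by
  calc _ ≤ ∫⁻ x in A, 2 * (‖φ x - d‖ₑ ^ 2 + ‖d - c‖ₑ ^ 2) := by
        gcongr with x
        rw [← sub_add_sub_cancel (φ x) d c]
        exact enorm_add_sq_le _ _
    _ = _ := by
        rw [lintegral_const_mul' _ _ (by simp), lintegral_add_right _ measurable_const,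
          setLIntegral_const, mul_comm (volume A)]

/-- The constants that belong to `U` and `V` are compared on the overlap `U ∩ V`. -/
theorem PoincareOn.union {Ω U V : Set Plane} (hU : PoincareOn Ω U) (hV : PoincareOn Ω V)
    (hpos : volume (U ∩ V) ≠ 0) (hfin : volume V ≠ ⊤) : PoincareOn Ω (U ∪ V) := by
  obtain ⟨C, hC, hU⟩ := hU
  obtain ⟨C', hC', hV⟩ := hV
  refine ⟨C + 2 * (C' + volume V * (2 * (C + C') / volume (U ∩ V))), ?_, fun φ hφ => ?_⟩
  · have : 2 * (C + C') / volume (U ∩ V) ≠ ⊤ := ENNReal.div_ne_top (by finiteness) hpos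
    finiteness
  obtain ⟨c, hc⟩ := hU φ hφ
  obtain ⟨d, hd⟩ := hV φ hφ
  set E := ∫⁻ x in Ω, ‖fderiv ℝ φ x‖ₑ ^ 2
  have hφc := hφ.continuous
  have hcd : ‖d - c‖ₑ ^ 2 ≤ 2 * (C + C') / volume (U ∩ V) * E := by
    rw [← ENNReal.mul_div_right_comm, ENNReal.le_div_iff_mul_le (.inl hpos)
      (.inl (measure_ne_top_of_subset inter_subset_right hfin))]
    calc ‖d - c‖ₑ ^ 2 * volume (U ∩ V) = ∫⁻ x in U ∩ V, ‖d - c‖ₑ ^ 2 := by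
          rw [setLIntegral_const]
      _ ≤ ∫⁻ x in U ∩ V, 2 * (‖φ x - c‖ₑ ^ 2 + ‖φ x - d‖ₑ ^ 2) := by
          gcongr with x
          rw [← sub_sub_sub_cancel_left c d (φ x), sub_eq_add_neg, ← enorm_neg (φ x - d)]
          exact enorm_add_sq_le _ _
      _ = 2 * ((∫⁻ x in U ∩ V, ‖φ x - c‖ₑ ^ 2) + ∫⁻ x in U ∩ V, ‖φ x - d‖ₑ ^ 2) := by
          rw [lintegral_const_mul' _ _ (by simp), lintegral_add_right _ (by fun_prop)]
      _ ≤ 2 * (C * E + C' * E) := by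
          gcongr
          · exact (lintegral_mono_set inter_subset_left).trans hc
          · exact (lintegral_mono_set inter_subset_right).trans hd
      _ = _ := by ring
  refine ⟨c, (lintegral_union_le _ _ _).trans ?_⟩
  calc _ ≤ C * E + 2 * (C' * E + volume V * (2 * (C + C') / volume (U ∩ V) * E)) := by
        gcongr
        refine (setLIntegral_enorm_sub_sq_le φ c d).trans ?_
        gcongr
    _ = _ := by ring

/-- `x` and `y` lie in a common open subset of `Ω` on which the Poincaré inequality holds. -/
def PoincareLinked (Ω : Set Plane) (x y : Plane) : Prop :=
  ∃ U, IsOpen U ∧ U ⊆ Ω ∧ PoincareOn Ω U ∧ x ∈ U ∧ y ∈ U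

theorem PoincareOn.union_of_mem {Ω U V : Set Plane} (hbdd : Bornology.IsBounded Ω)
    (hU : PoincareOn Ω U) (hV : PoincareOn Ω V) (hUo : IsOpen U) (hVo : IsOpen V)
    (hVΩ : V ⊆ Ω) {x : Plane} (hxU : x ∈ U) (hxV : x ∈ V) : PoincareOn Ω (U ∪ V) :=
  hU.union hV ((hUo.inter hVo).measure_pos volume ⟨x, hxU, hxV⟩).ne'
    (hbdd.subset hVΩ).measure_lt_top.ne

theorem poincareLinked_of_isConnected {Ω : Set Plane} (hΩ : IsOpen Ω) (hconn : IsConnected Ω)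
    (hbdd : Bornology.IsBounded Ω) {x y : Plane} (hx : x ∈ Ω) (hy : y ∈ Ω) :
    PoincareLinked Ω x y := by
  refine hconn.isPreconnected.induction₂ (PoincareLinked Ω) (fun x hx => ?_)
    (fun x y z _ _ _ hxy hyz => ?_) (fun x y _ _ hxy => ?_) hx hy
  · obtain ⟨U, hU, hUΩ, hP, ρ, hρ, hball⟩ := exists_graphBox_of_mem hΩ hx
    filter_upwards [mem_nhdsWithin_of_mem_nhds (ball_mem_nhds x hρ)] with y hy
    exact ⟨U, hU, hUΩ, hP, hball (mem_ball_self hρ), hball hy⟩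
  · obtain ⟨U, hU, hUΩ, hP, h1, h2⟩ := hxy
    obtain ⟨V, hV, hVΩ, hP', h1', h2'⟩ := hyz
    exact ⟨U ∪ V, hU.union hV, union_subset hUΩ hVΩ,
      hP.union_of_mem hbdd hP' hU hV hVΩ h2 h1', .inl h1, .inr h2'⟩
  · obtain ⟨U, hU, hUΩ, hP, h1, h2⟩ := hxy
    exact ⟨U, hU, hUΩ, hP, h2, h1⟩

/-- The **Poincaré inequality** on `Ω`. Any point of the closure has a neighbourhood whose part in `Ω`
lies, together with a fixed point of `Ω`, in an open set with the Poincaré inequality; finitely many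
of these suffice, and they overlap near the fixed point. -/
theorem poincareOn_self {Ω : Set Plane} (hΩ : IsOpen Ω) (hconn : IsConnected Ω)
    (hbdd : Bornology.IsBounded Ω) (hbd : HasC1Boundary Ω) : PoincareOn Ω Ω := by
  obtain ⟨x₀, hx₀⟩ := hconn.nonempty
  have key : ∃ U, IsOpen U ∧ U ⊆ Ω ∧ PoincareOn Ω U ∧ x₀ ∈ U ∧ closure Ω ∩ Ω ⊆ U := by
    refine hbdd.isCompact_closure.induction_on
      (p := fun S => ∃ U, IsOpen U ∧ U ⊆ Ω ∧ PoincareOn Ω U ∧ x₀ ∈ U ∧ S ∩ Ω ⊆ U)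
      ?_ ?_ ?_ ?_
    · obtain ⟨U, hU, hUΩ, hP, h1, -⟩ := poincareLinked_of_isConnected hΩ hconn hbdd hx₀ hx₀
      exact ⟨U, hU, hUΩ, hP, h1, by simp⟩
    · rintro S S' hS ⟨U, hU, hUΩ, hP, h1, h2⟩
      exact ⟨U, hU, hUΩ, hP, h1, (inter_subset_inter_left _ hS).trans h2⟩
    · rintro S S' ⟨U, hU, hUΩ, hP, h1, h2⟩ ⟨V, hV, hVΩ, hP', h1', h2'⟩
      refine ⟨U ∪ V, hU.union hV, union_subset hUΩ hVΩ,
        hP.union_of_mem hbdd hP' hU hV hVΩ h1 h1', .inl h1, ?_⟩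
      rw [union_inter_distrib_right]
      exact union_subset_union h2 h2'
    · intro x hx
      have hbox : ∃ U, IsOpen U ∧ U ⊆ Ω ∧ PoincareOn Ω U ∧ ∃ ρ > 0, ball x ρ ∩ Ω ⊆ U := by
        by_cases hxΩ : x ∈ Ω
        · obtain ⟨U, hU, hUΩ, hP, ρ, hρ, hball⟩ := exists_graphBox_of_mem hΩ hxΩ
          exact ⟨U, hU, hUΩ, hP, ρ, hρ, inter_subset_left.trans hball⟩
        · obtain ⟨U, hU, hUΩ, hP, ρ, hρ, hball, -⟩ :=
            exists_graphBox_of_mem_frontier hΩ hbd (hΩ.frontier_eq.ge ⟨hx, hxΩ⟩)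
          exact ⟨U, hU, hUΩ, hP, ρ, hρ, hball⟩
      obtain ⟨U, hU, hUΩ, hP, ρ, hρ, hball⟩ := hbox
      obtain ⟨y, hy, hyΩ⟩ := mem_closure_iff.1 hx _ isOpen_ball (mem_ball_self hρ)
      obtain ⟨V, hV, hVΩ, hP', h1, h2⟩ := poincareLinked_of_isConnected hΩ hconn hbdd hx₀ hyΩ
      exact ⟨ball x ρ, mem_nhdsWithin_of_mem_nhds (ball_mem_nhds x hρ), U ∪ V, hU.union hV,
        union_subset hUΩ hVΩ, hP.union_of_mem hbdd hP' hU hV hVΩ (hball ⟨hy, hyΩ⟩) h2, .inr h1,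
        hball.trans subset_union_left⟩
  obtain ⟨U, -, -, hP, -, h⟩ := key
  exact hP.mono fun x hx => h ⟨subset_closure hx, hx⟩

/-! ### The Sobolev space, the trace operator and Friedrichs's inequality -/

theorem continuous_integral_inner {α E : Type*} [MeasurableSpace α] {μ : Measure α}
    [NormedAddCommGroup E] [InnerProductSpace ℝ E] {f : α → E} (hf : MemLp f 2 μ) :
    Continuous fun u : Lp E 2 μ => ∫ x, inner ℝ (f x) (u x) ∂μ := by
  have h : (fun u : Lp E 2 μ => ∫ x, inner ℝ (f x) (u x) ∂μ) = fun u => inner ℝ (hf.toLp f) u := by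
    ext u
    rw [L2.inner_def]
    refine integral_congr_ae ?_
    filter_upwards [hf.coeFn_toLp] with x hx
    rw [hx]
  rw [h]
  fun_prop

theorem isClosed_weakGradientGraph (Ω : Set Plane) :
    IsClosed (weakGradientGraph Ω : Set (WithLp 2 (L2 Ω × L2Vec Ω))) := by
  have h : (weakGradientGraph Ω : Set (WithLp 2 (L2 Ω × L2Vec Ω))) =
      {p | ∀ φ : Plane → ℝ, ContDiff ℝ ∞ φ → HasCompactSupport φ → tsupport φ ⊆ Ω →
        ∀ i : Fin 2, ∫ x in Ω, p.fst x * (∇ φ x) i = - ∫ x in Ω, p.snd x i * φ x} := rfl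
  rw [h]
  simp only [ofPred_forall]
  refine isClosed_iInter fun φ => isClosed_iInter fun hφ => isClosed_iInter fun hc =>
    isClosed_iInter fun _ => isClosed_iInter fun i => isClosed_eq ?_ (Continuous.neg ?_)
  · have h1 : MemLp (fun x => (∇ φ x) i) 2 (volume.restrict Ω) :=
      (continuous_gradient_apply hφ i).memLp_of_hasCompactSupport
        (hasCompactSupport_gradient_apply hc i)
    simpa [Function.comp_def] using
      (continuous_integral_inner h1).comp (WithLp.continuous_fst 2 (L2 Ω) (L2Vec Ω))
  · have h1 : MemLp (fun x => φ x • EuclideanSpace.single i (1 : ℝ)) 2 (volume.restrict Ω) :=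
      (hφ.continuous.smul continuous_const).memLp_of_hasCompactSupport hc.smul_right
    have h2 := (continuous_integral_inner h1).comp (WithLp.continuous_snd 2 (L2 Ω) (L2Vec Ω))
    simpa [Function.comp_def, inner_smul_left, EuclideanSpace.inner_single_left, mul_comm] using h2

instance instCompleteSpaceH1 (Ω : Set Plane) : CompleteSpace (H1 Ω) :=
  (isClosed_weakGradientGraph Ω).completeSpace_coe

theorem norm_sq_eq {Ω : Set Plane} (v : H1 Ω) : ‖v‖ ^ 2 = ‖funOf v‖ ^ 2 + ‖gradOf v‖ ^ 2 :=
  WithLp.prod_norm_sq_eq_of_L2 (Subtype.val v : WithLp 2 (L2 Ω × L2Vec Ω))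

/-- The inclusion `H¹(Ω) → L²(Ω)` as a bounded operator. -/
def funL (Ω : Set Plane) : H1 Ω →L[ℝ] L2 Ω :=
  LinearMap.mkContinuous
    { toFun := funOf
      map_add' := fun _ _ => rfl
      map_smul' := fun _ _ => rfl } 1 fun v => by
    rw [one_mul]
    refine le_of_sq_le_sq ?_ (norm_nonneg v)
    rw [norm_sq_eq]
    exact le_add_of_nonneg_right (by positivity)

/-- The weak gradient `H¹(Ω) → L²(Ω)²` as a bounded operator. -/
def gradL (Ω : Set Plane) : H1 Ω →L[ℝ] L2Vec Ω :=
  LinearMap.mkContinuous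
    { toFun := gradOf
      map_add' := fun _ _ => rfl
      map_smul' := fun _ _ => rfl } 1 fun v => by
    rw [one_mul]
    refine le_of_sq_le_sq ?_ (norm_nonneg v)
    rw [norm_sq_eq]
    exact le_add_of_nonneg_left (by positivity)

theorem Lp_enorm_sq_eq_lintegral {α E : Type*} [MeasurableSpace α] {μ : Measure α}
    [NormedAddCommGroup E] {u : Lp E 2 μ} {f : α → E} (h : u =ᵐ[μ] f) :
    ‖u‖ₑ ^ 2 = ∫⁻ x, ‖f x‖ₑ ^ 2 ∂μ := by
  have h2 := eLpNorm_nnreal_pow_eq_lintegral (f := f) (μ := μ) (p := 2) two_ne_zero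
  norm_num at h2
  rw [Lp.enorm_def, eLpNorm_congr_ae h, h2]

theorem lintegral_enorm_gradient_sq (φ : Plane → ℝ) (μ : Measure Plane) :
    ∫⁻ x, ‖∇ φ x‖ₑ ^ 2 ∂μ = ∫⁻ x, ‖fderiv ℝ φ x‖ₑ ^ 2 ∂μ := by
  congr 1 with x
  rw [gradient, LinearIsometryEquiv.enorm_map]

/-- Restriction of functions on `Γ` to a part `S` of `Γ`. -/
def restrictL (Ω S : Set Plane) : L2Bdry Ω →L[ℝ] Lp ℝ 2 ((bdryMeasure Ω).restrict S) :=
  LpToLpRestrictCLM Plane ℝ ℝ (bdryMeasure Ω) 2 S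

theorem restrictL_coeFn {Ω : Set Plane} (S : Set Plane) (w : L2Bdry Ω) :
    restrictL Ω S w =ᵐ[(bdryMeasure Ω).restrict S] w :=
  LpToLpRestrictCLM_coeFn ℝ S w

theorem restrictL_eq_zero_iff {Ω S : Set Plane} (w : L2Bdry Ω) :
    restrictL Ω S w = 0 ↔ ∀ᵐ x ∂((bdryMeasure Ω).restrict S), w x = 0 := by
  rw [Lp.eq_zero_iff_ae_eq_zero]
  exact ⟨fun h => (restrictL_coeFn S w).symm.trans h, fun h => (restrictL_coeFn S w).trans h⟩

theorem exists_trace_bound {Ω : Set Plane} (hΩ : TraceBoundOn Ω (frontier Ω)) :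
    ∃ C : ℝ, 0 ≤ C ∧ ∀ p ∈ (restrictionGraph Ω).topologicalClosure, ‖p.2‖ ^ 2 ≤ C * ‖p.1‖ ^ 2 := by
  obtain ⟨C, hC, h⟩ := hΩ
  refine ⟨C.toReal, ENNReal.toReal_nonneg, fun p hp => ?_⟩
  refine closure_minimal (s := (restrictionGraph Ω : Set (H1 Ω × L2Bdry Ω)))
    (t := {p | ‖p.2‖ ^ 2 ≤ C.toReal * ‖p.1‖ ^ 2}) ?_ (isClosed_le (by fun_prop) (by fun_prop)) hp
  rintro p ⟨φ, hφ, -, h1, h2, h3⟩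
  have h4 := h φ (hφ.of_le (by simp))
  rw [← lintegral_enorm_gradient_sq, ← Lp_enorm_sq_eq_lintegral h1, ← Lp_enorm_sq_eq_lintegral h2]
    at h4
  have h5 : ‖p.2‖ₑ ^ 2 ≤ C * (‖funOf p.1‖ₑ ^ 2 + ‖gradOf p.1‖ₑ ^ 2) := by
    rw [Lp_enorm_sq_eq_lintegral h3]; exact h4
  have h6 := ENNReal.toReal_mono (by finiteness) h5
  rw [ENNReal.toReal_mul, ENNReal.toReal_add (by finiteness) (by finiteness)] at h6
  simpa [norm_sq_eq] using h6

/-- **Friedrichs's inequality**, with the restriction of the trace to `Γ₁` kept on the right-hand side.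
In this form it is stable under limits of smooth functions, whereas elements of `X` need not be
limits of smooth functions that vanish on `Γ₁`. -/
theorem exists_friedrichs_bound {Ω Γ₁ : Set Plane} (hbdd : Bornology.IsBounded Ω)
    (hP : PoincareOn Ω Ω)
    (hT : TraceBoundOn Ω (frontier Ω)) (hpos : 0 < bdryMeasure Ω Γ₁) :
    ∃ C : ℝ, 0 ≤ C ∧ ∀ p ∈ (restrictionGraph Ω).topologicalClosure,
      ‖funOf p.1‖ ^ 2 ≤ C * (‖gradOf p.1‖ ^ 2 + ‖restrictL Ω Γ₁ p.2‖ ^ 2) := by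
  obtain ⟨C, hC, hP⟩ := hP
  obtain ⟨D, hD, hT⟩ := hT
  have hvol : volume Ω ≠ ⊤ := hbdd.measure_lt_top.ne
  have hfin : bdryMeasure Ω Γ₁ ≠ ⊤ := by
    have h := hT (fun _ => 1) contDiff_const
    have h' : bdryMeasure Ω univ ≤ D * volume Ω := by
      have e : ∀ x, ‖fderiv ℝ (fun _ : Plane => (1 : ℝ)) x‖ₑ = 0 := fun x => by
        rw [← ofReal_norm]; simp
      simp only [e] at h
      simpa [bdryMeasure] using h
    exact ne_top_of_le_ne_top (by finiteness) ((measure_mono (subset_univ _)).trans h')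
  let m := bdryMeasure Ω Γ₁
  let B : ℝ≥0∞ := 2 * (C + volume Ω * (2 * (1 + D * (C + 1)) / m))
  have hB : B ≠ ⊤ := by
    have : 2 * (1 + D * (C + 1)) / m ≠ ⊤ := ENNReal.div_ne_top (by finiteness) hpos.ne'
    finiteness
  refine ⟨B.toReal, ENNReal.toReal_nonneg, fun p hp => ?_⟩
  refine closure_minimal (s := (restrictionGraph Ω : Set (H1 Ω × L2Bdry Ω)))
    (t := {p | ‖funOf p.1‖ ^ 2 ≤ B.toReal * (‖gradOf p.1‖ ^ 2 + ‖restrictL Ω Γ₁ p.2‖ ^ 2)}) ?_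
    (isClosed_le (((funL Ω).continuous.comp continuous_fst).norm.pow 2)
      (continuous_const.mul ((((gradL Ω).continuous.comp continuous_fst).norm.pow 2).add
        (((restrictL Ω Γ₁).continuous.comp continuous_snd).norm.pow 2)))) hp
  rintro p ⟨φ, hφ, -, h1, h2, h3⟩
  have hφ1 : ContDiff ℝ 1 φ := hφ.of_le (by simp)
  obtain ⟨c, hc⟩ := hP φ hφ1
  set G := ∫⁻ x in Ω, ‖fderiv ℝ φ x‖ₑ ^ 2 with hG
  have e2 : ‖gradOf p.1‖ₑ ^ 2 = G := by
    rw [Lp_enorm_sq_eq_lintegral h2, lintegral_enorm_gradient_sq]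
  have e3 : ‖restrictL Ω Γ₁ p.2‖ₑ ^ 2 = ∫⁻ x in Γ₁, ‖φ x‖ₑ ^ 2 ∂(bdryMeasure Ω) :=
    Lp_enorm_sq_eq_lintegral ((restrictL_coeFn Γ₁ p.2).trans (ae_restrict_of_ae h3))
  set R := ∫⁻ x in Γ₁, ‖φ x‖ₑ ^ 2 ∂(bdryMeasure Ω) with hR
  have hTc : ∫⁻ x in Γ₁, ‖φ x - c‖ₑ ^ 2 ∂(bdryMeasure Ω) ≤ D * (C * G + G) := by
    refine (setLIntegral_le_lintegral _ _).trans
      ((hT (fun x => φ x - c) (hφ1.sub contDiff_const)).trans ?_)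
    simp only [fderiv_sub_const]
    gcongr
  -- The constant `c` is controlled on `Γ₁`, where it differs from `φ` by the trace of `φ - c`.
  have hcm : ‖c‖ₑ ^ 2 ≤ 2 * (1 + D * (C + 1)) / m * (G + R) := by
    rw [← ENNReal.mul_div_right_comm, ENNReal.le_div_iff_mul_le (.inl hpos.ne') (.inl hfin)]
    calc ‖c‖ₑ ^ 2 * m = ∫⁻ x in Γ₁, ‖c‖ₑ ^ 2 ∂(bdryMeasure Ω) := by rw [setLIntegral_const]
      _ ≤ ∫⁻ x in Γ₁, 2 * (‖φ x‖ₑ ^ 2 + ‖φ x - c‖ₑ ^ 2) ∂(bdryMeasure Ω) := by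
          gcongr with x
          have e : c = φ x + -(φ x - c) := by ring
          rw [← enorm_neg (φ x - c)]
          nth_rw 1 [e]
          exact enorm_add_sq_le _ _
      _ = 2 * (R + ∫⁻ x in Γ₁, ‖φ x - c‖ₑ ^ 2 ∂(bdryMeasure Ω)) := by
          have := hφ.continuous
          rw [lintegral_const_mul' _ _ (by simp), lintegral_add_left (by fun_prop)]
      _ ≤ 2 * (R + D * (C * G + G)) := by gcongr
      _ ≤ 2 * (R + D * (C * G + G)) + 2 * (G + D * (C + 1) * R) := le_self_add
      _ = _ := by ring
  have h5 : ‖funOf p.1‖ₑ ^ 2 ≤ B * (‖gradOf p.1‖ₑ ^ 2 + ‖restrictL Ω Γ₁ p.2‖ₑ ^ 2) := by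
    rw [e2, e3, Lp_enorm_sq_eq_lintegral h1]
    have h6 := setLIntegral_enorm_sub_sq_le (A := Ω) φ 0 c
    simp only [sub_zero] at h6
    calc _ ≤ _ := h6
      _ ≤ 2 * (C * G + volume Ω * (2 * (1 + D * (C + 1)) / m * (G + R))) := by gcongr
      _ ≤ 2 * (C * G + volume Ω * (2 * (1 + D * (C + 1)) / m * (G + R))) + 2 * C * R :=
        le_self_add
      _ = _ := by simp only [B]; ring
  have h6 := ENNReal.toReal_mono (by finiteness) h5
  rw [ENNReal.toReal_mul, ENNReal.toReal_add (by finiteness) (by finiteness)] at h6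
  simpa using h6

section TraceOperator

variable {Ω : Set Plane}

/-- By the trace inequality the closed graph is single valued, so `trace Ω` is not the junk value `0`
of `Submodule.toLinearPMap`, but the operator with this graph. -/
theorem mem_closure_of_domain (hΩ : TraceBoundOn Ω (frontier Ω)) (v : (trace Ω).domain) :
    ((v : H1 Ω), trace Ω v) ∈ (restrictionGraph Ω).topologicalClosure := by
  obtain ⟨C, -, h⟩ := exists_trace_bound hΩ
  refine Submodule.mem_graph_toLinearPMap (fun p hp hp1 => ?_) v
  have := h p hp
  rw [hp1] at this
  simpa using le_antisymm (by simpa using this) (sq_nonneg ‖p.2‖)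

/-- On the closed graph, the `H¹(Ω)` norm of the first component dominates the norm of the pair; hence
the domain, its image under the first projection, is closed. -/
theorem completeSpace_domain (hΩ : TraceBoundOn Ω (frontier Ω)) :
    CompleteSpace (trace Ω).domain := by
  obtain ⟨C, hC, h⟩ := exists_trace_bound hΩ
  have hG : CompleteSpace (restrictionGraph Ω).topologicalClosure :=
    (Submodule.isClosed_topologicalClosure _).completeSpace_coe
  let f : (restrictionGraph Ω).topologicalClosure →L[ℝ] H1 Ω :=
    (ContinuousLinearMap.fst ℝ _ _).comp (restrictionGraph Ω).topologicalClosure.subtypeL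
  have hf : AntilipschitzWith (1 + Real.sqrt C).toNNReal f := by
    refine AddMonoidHomClass.antilipschitz_of_bound f fun p => ?_
    rw [Real.coe_toNNReal _ (by positivity)]
    have h1 : ‖p.1.2‖ ≤ Real.sqrt C * ‖p.1.1‖ := by
      refine le_of_sq_le_sq ?_ (by positivity)
      rw [mul_pow, Real.sq_sqrt hC]
      exact h p.1 p.2
    change max ‖p.1.1‖ ‖p.1.2‖ ≤ (1 + Real.sqrt C) * ‖p.1.1‖
    have := norm_nonneg p.1.1
    have := norm_nonneg p.1.2
    have := mul_nonneg (Real.sqrt_nonneg C) (norm_nonneg p.1.1)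
    exact max_le (by linarith) (by linarith)
  have hcl := hf.isClosed_range f.uniformContinuous
  have he : ((trace Ω).domain : Set (H1 Ω)) = range f := by
    ext v
    change v ∈ Submodule.map (LinearMap.fst ℝ (H1 Ω) (L2Bdry Ω)) _ ↔ _
    constructor
    · rintro ⟨p, hp, rfl⟩
      exact ⟨⟨p, hp⟩, rfl⟩
    · rintro ⟨p, rfl⟩
      exact ⟨p.1, p.2, rfl⟩
  have : IsClosed ((trace Ω).domain : Set (H1 Ω)) := he ▸ hcl
  exact this.completeSpace_coe

theorem exists_traceL (hΩ : TraceBoundOn Ω (frontier Ω)) :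
    ∃ τ : (trace Ω).domain →L[ℝ] L2Bdry Ω, ∀ v, τ v = trace Ω v := by
  obtain ⟨C, hC, h⟩ := exists_trace_bound hΩ
  have hb : ∀ v, ‖(trace Ω).toFun v‖ ≤ Real.sqrt C * ‖v‖ := fun v => by
    have h1 := h _ (mem_closure_of_domain hΩ v)
    refine le_of_sq_le_sq ?_ (mul_nonneg (Real.sqrt_nonneg C) (norm_nonneg v))
    rw [mul_pow, Real.sq_sqrt hC]
    exact h1
  exact ⟨(trace Ω).toFun.mkContinuous (Real.sqrt C) hb,
    fun v => (trace Ω).toFun.mkContinuous_apply _ hb v⟩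

theorem completeSpace_X (hΩ : TraceBoundOn Ω (frontier Ω)) (Γ₁ : Set Plane) :
    CompleteSpace (X Ω Γ₁) := by
  have := completeSpace_domain hΩ
  obtain ⟨τ, hτ⟩ := exists_traceL hΩ
  have h : (X Ω Γ₁ : Set (trace Ω).domain) = (restrictL Ω Γ₁ ∘L τ) ⁻¹' {0} := by
    ext v
    rw [mem_preimage, mem_singleton_iff, ContinuousLinearMap.comp_apply, hτ, restrictL_eq_zero_iff]
    rfl
  have hcl : IsClosed (X Ω Γ₁ : Set (trace Ω).domain) := by
    rw [h]
    exact isClosed_singleton.preimage (ContinuousLinearMap.continuous _)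
  exact hcl.completeSpace_coe

theorem norm_traceHalf (v : (trace Ω).domain) :
    ‖traceHalf Ω v‖ = ‖(Submodule.Quotient.mk v : (trace Ω).domain ⧸ (trace Ω).toFun.ker)‖ := by
  change ‖HHalf.equivQuot Ω (traceHalf Ω v)‖ = _
  congr 1
  exact LinearMap.quotKerEquivRange_symm_apply_image (trace Ω).toFun v _

/-- The trace `γ : X → M` as a bounded operator; it has norm at most one for the quotient norm on `M`. -/
def traceML (Ω Γ₁ : Set Plane) : X Ω Γ₁ →L[ℝ] M Ω Γ₁ :=
  (traceM Ω Γ₁).mkContinuous 1 fun v => by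
    rw [one_mul]
    exact (norm_traceHalf v.1).le.trans (Submodule.Quotient.norm_mk_le _ _)

/-- `M` carries the quotient norm of `X / ker γ`: a preimage in `H¹(Ω)` of a trace in `M` lies in `X`. -/
theorem exists_traceML_eq_norm_lt {Γ₁ : Set Plane} (w : M Ω Γ₁) (ε : ℝ) (hε : 0 < ε) :
    ∃ v, traceML Ω Γ₁ v = w ∧ ‖v‖ < ‖w‖ + ε := by
  obtain ⟨x, hxX, hx⟩ := w.2
  obtain ⟨d, hd, hdn⟩ := Submodule.Quotient.norm_mk_lt (HHalf.equivQuot Ω w.1) hε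
  have h1 : HHalf.equivQuot Ω (traceHalf Ω d) = HHalf.equivQuot Ω w.1 := by
    rw [← hd]
    exact LinearMap.quotKerEquivRange_symm_apply_image (trace Ω).toFun d _
  have h2 : traceHalf Ω d = w.1 := (HHalf.equivQuot Ω).injective h1
  have h3 : trace Ω d = trace Ω x := congrArg Subtype.val (h2.trans hx.symm)
  have hdX : d ∈ X Ω Γ₁ := by
    change ∀ᵐ y ∂((bdryMeasure Ω).restrict Γ₁), trace Ω d y = 0
    rw [h3]
    exact hxX
  exact ⟨⟨d, hdX⟩, Subtype.ext h2, hdn⟩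

theorem exists_norm_le_gradOf {Γ₁ : Set Plane} (hbdd : Bornology.IsBounded Ω)
    (hP : PoincareOn Ω Ω) (hT : TraceBoundOn Ω (frontier Ω)) (hpos : 0 < bdryMeasure Ω Γ₁) :
    ∃ C : ℝ, ∀ v : X Ω Γ₁, ‖v‖ ≤ C * ‖gradOf v.1.1‖ := by
  obtain ⟨C, hC, h⟩ := exists_friedrichs_bound hbdd hP hT hpos
  refine ⟨Real.sqrt (C + 1), fun v => ?_⟩
  refine le_of_sq_le_sq ?_ (by positivity)
  have h1 := h _ (mem_closure_of_domain hT v.1)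
  have h2 : restrictL Ω Γ₁ (trace Ω v.1) = 0 := (restrictL_eq_zero_iff _).2 v.2
  simp only [h2, norm_zero] at h1
  change ‖v.1.1‖ ^ 2 ≤ _
  rw [norm_sq_eq, mul_pow, Real.sq_sqrt (by positivity)]
  linarith

theorem exists_loadL (hT : TraceBoundOn Ω (frontier Ω)) (Γ₁ Γ₂ : Set Plane) (f₀ : L2 Ω)
    (f₂ : Lp ℝ 2 ((bdryMeasure Ω).restrict Γ₂)) :
    ∃ F : StrongDual ℝ (X Ω Γ₁), ∀ v, F v = load Γ₂ f₀ f₂ v := by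
  obtain ⟨τ, hτ⟩ := exists_traceL hT
  refine ⟨(innerSL ℝ f₀ ∘L funL Ω ∘L (trace Ω).domain.subtypeL ∘L (X Ω Γ₁).subtypeL) +
    (innerSL ℝ f₂ ∘L restrictL Ω Γ₂ ∘L τ ∘L (X Ω Γ₁).subtypeL), fun v => ?_⟩
  change inner ℝ f₀ (funOf v.1.1) + inner ℝ f₂ (restrictL Ω Γ₂ (τ v.1)) = _
  rw [L2.inner_def, L2.inner_def, hτ, load]
  congr 1
  · simp [mul_comm]
  · refine integral_congr_ae ?_
    filter_upwards [restrictL_coeFn Γ₂ (trace Ω v.1)] with x hx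
    rw [hx]
    simp [mul_comm]

end TraceOperator

end AntiplaneContact

end

theorem theorem3p2 (Ω Γ₁ Γ₂ Γ₃ : Set AntiplaneContact.Plane)
    (hopen : IsOpen Ω) (hconn : IsConnected Ω) (hbdd : Bornology.IsBounded Ω)
    (hbdry : AntiplaneContact.HasC1Boundary Ω)
    (hpart : AntiplaneContact.IsBoundaryPartition Ω Γ₁ Γ₂ Γ₃)
    (ξ g : ℝ) (hξ : 0 < ξ) (hg : 0 < g)
    (f₀ : AntiplaneContact.L2 Ω)
    (f₂ : MeasureTheory.Lp ℝ 2 ((AntiplaneContact.bdryMeasure Ω).restrict Γ₂)) :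
    ∃! p : AntiplaneContact.X Ω Γ₁ × AntiplaneContact.Y Ω Γ₁,
      AntiplaneContact.IsMixedSolution Ω Γ₁ Γ₂ Γ₃ ξ g f₀ f₂ p.1 p.2 := by
  have hT := AntiplaneContact.traceBoundOn_frontier hopen hbdd hbdry
  have hP := AntiplaneContact.poincareOn_self hopen hconn hbdd hbdry
  have := AntiplaneContact.completeSpace_X hT Γ₁
  obtain ⟨C, hC⟩ := AntiplaneContact.exists_norm_le_gradOf hbdd hP hT hpart.pos₁
  obtain ⟨F, hF⟩ := AntiplaneContact.exists_loadL hT Γ₁ Γ₂ f₀ f₂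
  have key := AntiplaneContact.existsUnique_saddle_point
    (AntiplaneContact.gradL Ω ∘L (AntiplaneContact.trace Ω).domain.subtypeL ∘L
      (AntiplaneContact.X Ω Γ₁).subtypeL) hC (AntiplaneContact.traceML Ω Γ₁)
    AntiplaneContact.exists_traceML_eq_norm_lt
    (j := fun v => ∫ x in Γ₃, g * |AntiplaneContact.trace Ω v.1 x|
      ∂(AntiplaneContact.bdryMeasure Ω))
    (fun v => integral_nonneg fun x => by positivity) (fun v hv => ?_) hξ F
  · simp only [hF] at key
    exact key
  · have h0 : AntiplaneContact.trace Ω v.1 = 0 := congrArg Subtype.val (congrArg Subtype.val hv)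
    refine integral_eq_zero_of_ae ?_
    rw [h0]
    filter_upwards [ae_restrict_of_ae (Lp.coeFn_zero ℝ 2 (AntiplaneContact.bdryMeasure Ω))]
      with x hx
    change g * |(0 : AntiplaneContact.L2Bdry Ω) x| = 0
    rw [hx, Pi.zero_apply, abs_zero, mul_zero]
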